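/- **Layered automata.** A layered automaton $\mathcal A$ over an alphabet $\Sigma$ consists of deterministic transition systems $\mathcal T_1,\dots,\mathcal T_d$ ($d\ge 1$) with finite pairwise disjoint state sets $Q_1,\dots,Q_d$ and partial transition functions $\delta_x\colon Q_x\times\Sigma\to Q_x\cup\{\bot\}$, and of morphisms $\mu_x\colon\mathcal T_{x+1}\to\mathcal T_x$ ($1\le x<d$; if $q\xrightarrow{a}q'$ in $\mathcal T_{x+1}$ then $\mu_x(q)\xrightarrow{a}\mu_x(q')$ in $\mathcal T_x$). $\mathcal T_1$ is complete and has an initial state $q_{\mathsf{init}}$ from which all of $Q_1$ is reachable. Put $Q_{\ge x}=Q_x\cup\dots\cup Q_d$. The states of $\mathcal A$ are the elements of $Q_{\ge1}$; a state of $Q_x$ has layer $x$. For $q\in Q_{\geq x}$ let $\hat\mu_x(q)\in Q_x$ be its ancestor in layer $x$, obtained by composing the $\mu_y$ (each state is an ancestor of itself). A leaf is a state that is in the image of no $\mu_x$. **Semantics.** For a leaf $q$ and $a\in\Sigma$ let $x(q,a)$ be the largest $x$ such that $q\in Q_{\ge x}$ and $\delta_x(\hat\mu_x(q),a)$ is defined.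 The semantics automaton $[\![\mathcal A]\!]$ is the alternating parity automaton whose states are the leaves and which has a transition of priority $x=x(q,a)$ from $q$ over $a$ to every leaf $q'\in Q_{\ge x}$ with $\hat\mu_x(q')=\delta_x(\hat\mu_x(q),a)$. On an infinite word, Eve chooses the transition when the priority is odd, Adam when it is even, and Eve wins if the $\liminf$ of the priorities is even; $L([\![\mathcal A]\!],q)$ is the set of words $w\in\Sigma^\omega$ for which Eve has a winning strategy from $q$. For a state $p$, $L(p)$ is the language $L([\![\mathcal A]\!],q)$ of a leaf $q$ having $p$ as an ancestor (for consistent $\mathcal A$, see below, the choice of $q$ is irrelevant), and $L(\mathcal A)=L(q_{\mathsf{init}})$. Two automata are equivalent if they have the same language. **Properties.** For $q\in Q_{\ge x}$ the $x$-safe language $L^{\mathrm{safe}}_x(q)\subseteq\Sigma^*\cup\Sigma^\omega$ is the set of words over which the run from $\hat\mu_x(q)$ in $\mathcal T_x$ is defined. Let $p\in Q_x$ and $w\in L^{\mathrm{safe}}_x(p)\cap\Sigma^\omega$ be such that there are no decomposition $w=uw'$ and $p'\in Q_{x+1}$ with $p\xrightarrow{u}\mu_x(p')$ in $\mathcal T_x$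 and $w'\in L^{\mathrm{safe}}_{x+1}(p')$ (where $Q_{d+1}=\emptyset$). Then $w$ is strongly accepted by $p$ if $x$ is even, and strongly rejected by $p$ if $x$ is odd. The automaton $\mathcal A$ is * *consistent* if there are no states $p,p'$ with $\hat\mu_1(p)=\hat\mu_1(p')$ and no $w\in\Sigma^\omega$ that is strongly accepted by $p$ and strongly rejected by $p'$; * *normal* if for all $x\ge2$ and $q\in Q_x$: whenever $q\xrightarrow{u}q'$ in $\mathcal T_x$ with $u\in\Sigma^*$, there is $v\in\Sigma^+$ with $q'\xrightarrow{v}q$ in $\mathcal T_x$; and for every $p\in\mu_x^{-1}(q)$ there is $u\in\Sigma^*$ whose run is defined from $q$ in $\mathcal T_x$ but not from $p$ in $\mathcal T_{x+1}$; * *centralised* if for all $x\ge2$ and $p,q\in Q_x$ with $\mu_{x-1}(p)=\mu_{x-1}(q)$ and $L^{\mathrm{safe}}_x(p)\subseteq L^{\mathrm{safe}}_x(q)$, the states $p,q$ are in the same strongly connected component of $\mathcal T_x$; * *safe minimal* if for all $x\ge1$ and $p,q\in Q_x$ with $L(p)=L(q)$ and $L^{\mathrm{safe}}_y(p)=L^{\mathrm{safe}}_y(q)$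 for all $1<y\le x$, one has $p=q$. **Morphisms.** A morphism $\mathcal A\to\mathcal A'$ is a map $\varphi\colon Q_{\ge1}\to Q'_{\ge1}$ with $\varphi(q_{\mathsf{init}})=q'_{\mathsf{init}}$, such that $q\xrightarrow{a}q'$ in $\mathcal T_x$ implies $\varphi(q)\xrightarrow{a}\varphi(q')$ in the layer $\mathcal T'_y$ of $\varphi(q)$, and such that $\varphi(p)$ is an ancestor of $\varphi(q)$ whenever $p$ is an ancestor of $q$. It is strong if moreover $\varphi(q)$ has no $a$-transition in its layer whenever $q$ has none in its layer. A layered automaton $\mathcal A'$ is a subautomaton of $\mathcal A$ if there is an injective morphism $\mathcal A'\to\mathcal A$. **Statement.** Let $\mathcal A_L$ be a consistent layered automaton that is normal, centralised and safe minimal. Then every consistent layered automaton $\mathcal A$ equivalent to $\mathcal A_L$ has a subautomaton that admits a surjective strong morphism onto $\mathcal A_L$. Moreover $\mathcal A$ has at least as many states as $\mathcal A_L$, and $[\![\mathcal A]\!]$ has at least as many states as $[\![\mathcal A_L]\!]$. -/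

import Mathlib

universe u v w

/-! ## Simple-by-priorities alternating parity automata -/

/-- A simple-by-priorities alternating parity automaton (without a distinguished initial state)
over the alphabet `α`, with priorities in `{1, …, d}`: a complete transition system in which all
`a`-transitions from a state `q` carry one and the same priority, `priority q a`. -/
structure SimpleParityAutomaton (α : Type u) (Q : Type v) where
  d : ℕ
  priority : Q → α → ℕ
  step : Q → α → Q → Prop
  one_le_priority : ∀ q a, 1 ≤ priority q a
  priority_le : ∀ q a, priority q a ≤ d
  complete : ∀ q a, ∃ q', step q a q'

namespace SimpleParityAutomaton

variable {α : Type u} {Q : Type v} (B : SimpleParityAutomaton α Q)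

/-- `ρ` is an infinite run over the infinite word `w` from `q`. -/
def IsRun (q : Q) (w : ℕ → α) (ρ : ℕ → Q) : Prop :=
  ρ 0 = q ∧ ∀ i, B.step (ρ i) (w i) (ρ (i + 1))

/-- Min-parity condition: the limit inferior of the priorities seen along the run is even. -/
def Accepting (w : ℕ → α) (ρ : ℕ → Q) : Prop :=
  Even (Filter.liminf (fun i => B.priority (ρ i) (w i)) Filter.atTop)

/-- `σ` is a strategy for Eve in the acceptance game over `w`. Its arguments are the list of the
states visited strictly before the current one and the current state; whenever the current
priority is odd, so that Eve moves, `σ` has to propose a legal successor. -/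
def IsEveStrategy (w : ℕ → α) (σ : List Q → Q → Q) : Prop :=
  ∀ (h : List Q) (q : Q), Odd (B.priority q (w h.length)) → B.step q (w h.length) (σ h q)

/-- The run `ρ` follows the strategy `σ` of Eve. -/
def Follows (w : ℕ → α) (σ : List Q → Q → Q) (ρ : ℕ → Q) : Prop :=
  ∀ i, Odd (B.priority (ρ i) (w i)) → ρ (i + 1) = σ ((List.range i).map ρ) (ρ i)

/-- The language of the state `q`: the infinite words `w` such that Eve has a winning strategy in
the acceptance game over `w` started at `q`. Eve picks the transition when the priority is odd,
Adam when it is even, and Eve wins if the resulting run is accepting. -/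
def lang (q : Q) : Set (ℕ → α) :=
  {w | ∃ σ, B.IsEveStrategy w σ ∧
    ∀ ρ, B.IsRun q w ρ → B.Follows w σ ρ → B.Accepting w ρ}

end SimpleParityAutomaton

/-! ## Layered automata -/

/-- A layered automaton over `α`, whose set of all states (the disjoint union of the state sets of
its layers `1, …, d`) is `Q`. The state set of the `x`-th layer is `{q | layer q = x}`, the
deterministic transition systems of all layers are given by the single partial function `δ`, which
stays inside each layer, and all the morphisms from layer `x + 1` to layer `x` are given by the
single map `μ`. The value of `μ` on states of layer `1` is never used. -/
structure LayeredAutomaton (α : Type u) (Q : Type v) where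
  d : ℕ
  layer : Q → ℕ
  one_le_layer : ∀ q, 1 ≤ layer q
  layer_le : ∀ q, layer q ≤ d
  δ : Q → α → Option Q
  layer_δ : ∀ q a q', δ q a = some q' → layer q' = layer q
  μ : Q → Q
  layer_μ : ∀ q, 2 ≤ layer q → layer (μ q) + 1 = layer q
  μ_morphism : ∀ q a q', 2 ≤ layer q → δ q a = some q' → δ (μ q) a = some (μ q')
  complete_one : ∀ q a, layer q = 1 → (δ q a).isSome
  init : Q
  layer_init : layer init = 1
  reachable_one : ∀ q, layer q = 1 → ∃ u : List α, u.foldlM δ init = some q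

namespace LayeredAutomaton

variable {α : Type u} {Q : Type v} (A : LayeredAutomaton α Q)

/-- The state reached from `q` by reading the finite word `u` inside the layer of `q`, or `none` if
the run dies. -/
def run (q : Q) (u : List α) : Option Q := u.foldlM A.δ q

/-- The ancestor of `q` at layer `x`; meaningful for `1 ≤ x ≤ layer q`. -/
def up (x : ℕ) (q : Q) : Q := A.μ^[A.layer q - x] q

/-- `p` is an ancestor of `q` (every state is an ancestor of itself). -/
def IsAncestor (p q : Q) : Prop := A.layer p ≤ A.layer q ∧ A.up (A.layer p) q = p

/-- Leaf states: those that are not in the image of any of the layer morphisms. -/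
def IsLeaf (q : Q) : Prop := ¬ ∃ p, 2 ≤ A.layer p ∧ A.μ p = q

/-- The type of leaf states. -/
abbrev Leaf : Type v := {q : Q // A.IsLeaf q}

theorem layer_iterate_μ (n : ℕ) (q : Q) (h : n < A.layer q) :
    A.layer (A.μ^[n] q) + n = A.layer q := by
  induction n with
  | zero => simp
  | succ n ih =>
    rw [Function.iterate_succ_apply']
    have h1 := ih (by omega)
    have h2 := A.layer_μ (A.μ^[n] q) (by omega)
    omega

theorem layer_up (x : ℕ) (q : Q) (h1 : 1 ≤ x) (h2 : x ≤ A.layer q) :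
    A.layer (A.up x q) = x := by
  have h3 := A.layer_iterate_μ (A.layer q - x) q (by omega)
  unfold up
  omega

theorem isAncestor_refl (q : Q) : A.IsAncestor q q := by
  refine ⟨le_refl _, ?_⟩
  simp [up]

theorem isAncestor_of_μ (p q : Q) (hq : 2 ≤ A.layer q) (h : A.IsAncestor q p) :
    A.IsAncestor (A.μ q) p := by
  obtain ⟨h1, h2⟩ := h
  have h3 := A.layer_μ q hq
  refine ⟨by omega, ?_⟩
  unfold up at h2 ⊢
  have h4 : A.layer p - A.layer (A.μ q) = (A.layer p - A.layer q) + 1 := by omega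
  rw [h4, Function.iterate_succ_apply', h2]

/-- Below every state there is a leaf state. -/
theorem exists_leaf (p : Q) : ∃ q : A.Leaf, A.IsAncestor p q := by
  by_cases h : A.IsLeaf p
  · exact ⟨⟨p, h⟩, A.isAncestor_refl p⟩
  · unfold IsLeaf at h
    rw [not_not] at h
    obtain ⟨q, hq, rfl⟩ := h
    have h1 := A.layer_μ q hq
    have h2 := A.layer_le q
    obtain ⟨l, hl⟩ := exists_leaf q
    exact ⟨l, A.isAncestor_of_μ l q hq hl⟩
termination_by A.d - A.layer p

open Classical in
/-- The biggest layer `x` (between `1` and the layer of `q`) in which the ancestor of `q` at layer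
`x` has an `a`-transition. -/
noncomputable def actionLayer (q : Q) (a : α) : ℕ :=
  Nat.findGreatest (fun x => (A.δ (A.up x q) a).isSome) (A.layer q)

theorem one_le_actionLayer (q : Q) (a : α) : 1 ≤ A.actionLayer q a := by
  classical
  unfold actionLayer
  exact Nat.le_findGreatest (A.one_le_layer q)
    (A.complete_one _ a (A.layer_up 1 q le_rfl (A.one_le_layer q)))

theorem actionLayer_le (q : Q) (a : α) : A.actionLayer q a ≤ A.layer q := by
  classical
  exact Nat.findGreatest_le _

theorem actionLayer_spec (q : Q) (a : α) : (A.δ (A.up (A.actionLayer q a) q) a).isSome := by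
  classical
  exact Nat.findGreatest_spec (P := fun x => (A.δ (A.up x q) a).isSome) (A.one_le_layer q)
    (A.complete_one _ a (A.layer_up 1 q le_rfl (A.one_le_layer q)))

/-- The semantics automaton: its states are the leaf states, and from the leaf `q`, for
`x = actionLayer q a`, there is an `a`-transition of priority `x` to every leaf `q'` whose
ancestor at layer `x` is the `a`-successor, in layer `x`, of the ancestor of `q`. -/
noncomputable def sem : SimpleParityAutomaton α A.Leaf where
  d := A.d
  priority q a := A.actionLayer q a
  step q a q' := A.actionLayer q a ≤ A.layer q' ∧
    A.δ (A.up (A.actionLayer q a) q) a = some (A.up (A.actionLayer q a) q')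
  one_le_priority q a := A.one_le_actionLayer q a
  priority_le q a := (A.actionLayer_le q a).trans (A.layer_le q)
  complete q a := by
    obtain ⟨p, hp⟩ := Option.isSome_iff_exists.mp (A.actionLayer_spec q a)
    have h1 := A.layer_δ _ _ _ hp
    rw [A.layer_up _ _ (A.one_le_actionLayer q a) (A.actionLayer_le q a)] at h1
    obtain ⟨l, hl1, hl2⟩ := A.exists_leaf p
    rw [h1] at hl1 hl2
    exact ⟨l, hl1, by rw [hp, hl2]⟩

/-- The language of a state `p`: the words accepted by the semantics automaton from a leaf below
`p`. If `p` is itself a leaf this is its language in the semantics automaton; if the automaton is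
consistent, it does not depend on the chosen leaf. -/
def stateLang (p : Q) : Set (ℕ → α) :=
  {w | ∃ q : A.Leaf, A.IsAncestor p q ∧ w ∈ A.sem.lang q}

/-- The language recognised by the layered automaton: that of its semantics automaton, started in
a leaf below the initial state of the first layer. -/
def language : Set (ℕ → α) := A.stateLang A.init

/-- The `x`-safe language of `q`: the finite and infinite words over which there is a run, in layer
`x`, from the ancestor of `q` at layer `x`. Meaningful for `1 ≤ x ≤ layer q`. -/
def safeLang (x : ℕ) (q : Q) : Set (List α ⊕ (ℕ → α)) :=
  {v | match v with
    | Sum.inl u => (A.run (A.up x q) u).isSome = true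
    | Sum.inr w => ∃ ρ : ℕ → Q, ρ 0 = A.up x q ∧ ∀ i, A.δ (ρ i) (w i) = some (ρ (i + 1))}

/-- The infinite word `w` is safe from `p` in the layer `x` of `p`, and for no decomposition of `w`
into a finite prefix and a suffix is there a state `p'` of layer `x + 1` such that the prefix leads
from `p` to the parent of `p'` and the suffix is safe from `p'` in layer `x + 1`. -/
def StronglyDecided (p : Q) (w : ℕ → α) : Prop :=
  Sum.inr w ∈ A.safeLang (A.layer p) p ∧
  ∀ n : ℕ, ¬ ∃ p', A.layer p' = A.layer p + 1 ∧
    A.run p ((List.range n).map w) = some (A.μ p') ∧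
    Sum.inr (fun i => w (n + i)) ∈ A.safeLang (A.layer p + 1) p'

/-- `w` is strongly accepted by `p`. -/
def StronglyAccepted (p : Q) (w : ℕ → α) : Prop :=
  Even (A.layer p) ∧ A.StronglyDecided p w

/-- `w` is strongly rejected by `p`. -/
def StronglyRejected (p : Q) (w : ℕ → α) : Prop :=
  Odd (A.layer p) ∧ A.StronglyDecided p w

/-- No word is strongly accepted by one state and strongly rejected by another one that has the
same ancestor in the first layer. -/
def Consistent : Prop :=
  ¬ ∃ (p p' : Q) (w : ℕ → α), A.up 1 p = A.up 1 p' ∧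
    A.StronglyAccepted p w ∧ A.StronglyRejected p' w

/-- Normal form: on each layer `x ≥ 2`, all runs can return to their origin by a non-empty word,
and every child has a strictly smaller safe language than its parent. -/
def Normal : Prop :=
  ∀ q, 2 ≤ A.layer q →
    (∀ (u : List α) (q' : Q), A.run q u = some q' → ∃ v : List α, v ≠ [] ∧ A.run q' v = some q) ∧
    (∀ p, 2 ≤ A.layer p → A.μ p = q → ∃ u : List α, (A.run q u).isSome ∧ A.run p u = none)

/-- `p` and `q` are in the same strongly connected component of their layer. -/
def SameSCC (p q : Q) : Prop :=
  (∃ u : List α, A.run p u = some q) ∧ ∃ v : List α, A.run q v = some p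

/-- Centralised: on each layer `x ≥ 2`, if `p` and `q` have the same parent and the safe language
of `p` is contained in that of `q`, then `p` and `q` are in the same component. -/
def Centralised : Prop :=
  ∀ (x : ℕ) (p q : Q), 2 ≤ x → A.layer p = x → A.layer q = x → A.μ p = A.μ q →
    A.safeLang x p ⊆ A.safeLang x q → A.SameSCC p q

/-- Equivalence up to layer `x`: equal languages, and equal `y`-safe languages for `1 < y ≤ x`. -/
def SafeEquiv (x : ℕ) (p q : Q) : Prop :=
  A.stateLang p = A.stateLang q ∧ ∀ y, 1 < y → y ≤ x → A.safeLang y p = A.safeLang y q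

/-- Safe minimal: distinct states of a layer `x` are never equivalent up to `x`. -/
def SafeMinimal : Prop :=
  ∀ (x : ℕ) (p q : Q), A.layer p = x → A.layer q = x → A.SafeEquiv x p q → p = q

end LayeredAutomaton

/-! ## Morphisms -/

namespace LayeredAutomaton

/-- Morphisms of layered automata. States may change layer: the `a`-transition of `φ q` is taken in
the layer of `φ q`. -/
structure IsMorphism {α : Type u} {Q : Type v} {Q' : Type w} (A : LayeredAutomaton α Q)
    (A' : LayeredAutomaton α Q') (φ : Q → Q') : Prop where
  map_init : φ A.init = A'.init
  map_δ : ∀ q a q', A.δ q a = some q' → A'.δ (φ q) a = some (φ q')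
  map_ancestor : ∀ p q, A.IsAncestor p q → A'.IsAncestor (φ p) (φ q)

/-- Strong morphisms: they preserve non-transitions as well. -/
structure IsStrongMorphism {α : Type u} {Q : Type v} {Q' : Type w} (A : LayeredAutomaton α Q)
    (A' : LayeredAutomaton α Q') (φ : Q → Q') : Prop extends IsMorphism A A' φ where
  map_none : ∀ q a, A.δ q a = none → A'.δ (φ q) a = none

/-- `A'` is a subautomaton of `A`: there is an injective morphism from `A'` to `A`. -/
def IsSubautomaton {α : Type u} {Q' : Type w} {Q : Type v} (A' : LayeredAutomaton α Q')
    (A : LayeredAutomaton α Q) : Prop :=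
  ∃ φ : Q' → Q, IsMorphism A' A φ ∧ Function.Injective φ

end LayeredAutomaton

/-! Let `AL` be the canonical automaton and `A` an equivalent consistent one.

*Games.* In a play of the semantics automaton, the player who would lose if the `liminf` of the
priorities is `x` can always move below a child, in layer `x + 1`, from which the rest of the word
is safe, if there is one (`IsSafeChoice`). Hence the state of layer `x` that the play follows in
the end strongly decides the rest of the word. In a consistent automaton a word is therefore
accepted from `p` if and only if no state that can be reached from the ancestor of `p` in the first
layer strongly rejects a suffix of it (`Consistent.mem_sem_lang_iff`), and everything below is about
strong decision only.

*Loops.* Let `M` be a set of finite words which lead from `p` back to `p`, closed under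
concatenation. There is a word `k` in `M` after which only those runs survive that are at a state
from which every word of `M` is safe. So either `p` strongly decides the infinite power of `k`, or
`M` is safe from some child of `p` (`stronglyDecided_omegaPow_or`).

*Recurrent pairs.* For `p` in `AL` and `r` in `A` such that every word safe from `p` is safe from
`r`, read words in both components, and descend in the second component as long as the inclusion of
safe languages holds. A pair that is recurrent for these moves has no child of `r` that could
replace `r`, and by normality no child of `p` allows all the loops of the pair. So both components
strongly decide the infinite power of a purging loop, and their layers have the same parity
(`IsRecurrent.even_layer_iff`).

*Representatives.* A state `r` represents `p` if it lies below a representative of the parent of `p`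
and forms a recurrent pair with `p` (`Represents`). Parity shows that it lies properly below.
Every state has a representative (`exists_represents`). The core is that `p` is determined by
`r`: let two siblings `p`, `q` be represented by comparable states `r`, `s`. A word that mixes the
loops at both pairs is strongly decided by the upper one of `r` and `s`, so by parity it is not
strongly decided by the common parent of `p` and `q`, and all the loops are safe from some child `c`
of this parent. Centralisation puts `p`, `q` and `c` into one component, and for a maximal `c` the
loops are also safe from `p` and from `q`. Hence the safe languages of `p` and `q` agree, and safe
minimality gives `p = q` (`IsRecurrent.eq_of_isAncestor_of_μ_eq`).

The representatives, with the layers and transitions of the states that they represent, form the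
required subautomaton. -/

namespace LayeredAutomaton

section Basic

variable {α : Type u} {Q : Type v} (A : LayeredAutomaton α Q)

/-! ### Runs and ancestors -/

@[simp] theorem run_nil (q : Q) : A.run q [] = some q := rfl

theorem run_cons (q : Q) (a : α) (l : List α) :
    A.run q (a :: l) = (A.δ q a).bind fun q' => A.run q' l := rfl

theorem run_append (q : Q) (l l' : List α) :
    A.run q (l ++ l') = (A.run q l).bind fun q' => A.run q' l' := by
  simp only [run, List.foldlM_append]; rfl

theorem run_append_of_run_eq_some {q q' : Q} {l : List α} (h : A.run q l = some q') (l' : List α) :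
    A.run q (l ++ l') = A.run q' l' := by
  rw [run_append, h]; rfl

theorem run_singleton (q : Q) (a : α) : A.run q [a] = A.δ q a := by
  rw [run_cons]; cases A.δ q a <;> rfl

theorem exists_run_of_isSome_run_append {q : Q} {l l' : List α} (h : (A.run q (l ++ l')).isSome) :
    ∃ q', A.run q l = some q' ∧ (A.run q' l').isSome := by
  rw [run_append] at h
  cases h' : A.run q l with
  | none => simp [h'] at h
  | some q' => exact ⟨q', rfl, by simpa [h'] using h⟩

theorem layer_run {q q' : Q} {l : List α} (h : A.run q l = some q') : A.layer q' = A.layer q := by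
  induction l generalizing q with
  | nil => simp at h; rw [h]
  | cons a l ih =>
    rw [run_cons, Option.bind_eq_some_iff] at h
    obtain ⟨q₁, h₁, h₂⟩ := h
    rw [ih h₂, A.layer_δ _ _ _ h₁]

theorem run_μ {q q' : Q} {l : List α} (hq : 2 ≤ A.layer q) (h : A.run q l = some q') :
    A.run (A.μ q) l = some (A.μ q') := by
  induction l generalizing q with
  | nil => simp at h; rw [h]; rfl
  | cons a l ih =>
    rw [run_cons, Option.bind_eq_some_iff] at h
    obtain ⟨q₁, h₁, h₂⟩ := h
    rw [run_cons, A.μ_morphism _ _ _ hq h₁]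
    exact ih (by rw [A.layer_δ _ _ _ h₁]; exact hq) h₂

theorem run_iterate_μ {q q' : Q} {l : List α} (n : ℕ) (hq : n < A.layer q)
    (h : A.run q l = some q') : A.run (A.μ^[n] q) l = some (A.μ^[n] q') := by
  induction n with
  | zero => exact h
  | succ n ih =>
    rw [Function.iterate_succ_apply', Function.iterate_succ_apply']
    have := A.layer_iterate_μ n q (by omega)
    exact A.run_μ (by omega) (ih (by omega))

theorem run_up {q q' : Q} {l : List α} {x : ℕ} (hx : 1 ≤ x) (h : A.run q l = some q') :
    A.run (A.up x q) l = some (A.up x q') := by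
  have h₁ := A.one_le_layer q
  unfold up
  rw [A.layer_run h]
  exact A.run_iterate_μ _ (by omega) h

@[simp] theorem up_layer_self (q : Q) : A.up (A.layer q) q = q := by simp [up]

theorem up_up {x y : ℕ} {q : Q} (hx : 1 ≤ x) (hxy : x ≤ y) (hy : y ≤ A.layer q) :
    A.up x (A.up y q) = A.up x q := by
  have h := A.layer_up y q (by omega) hy
  unfold up at h ⊢
  rw [h, ← Function.iterate_add_apply]
  congr 1
  omega

theorem up_μ {x : ℕ} {q : Q} (hq : 2 ≤ A.layer q) (hx : x < A.layer q) :
    A.up x (A.μ q) = A.up x q := by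
  have h := A.layer_μ q hq
  unfold up
  rw [← Function.iterate_succ_apply]
  congr 1
  omega

theorem up_of_layer_eq_succ {x : ℕ} {q : Q} (hq : A.layer q = x + 1) : A.up x q = A.μ q := by
  simp [up, hq]

variable {A}

theorem isAncestor_up {x : ℕ} {q : Q} (hx : 1 ≤ x) (hxq : x ≤ A.layer q) :
    A.IsAncestor (A.up x q) q := by
  rw [IsAncestor, A.layer_up x q hx hxq]
  exact ⟨hxq, rfl⟩

theorem isAncestor_μ {q : Q} (hq : 2 ≤ A.layer q) : A.IsAncestor (A.μ q) q :=
  A.isAncestor_of_μ q q hq (A.isAncestor_refl q)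

theorem IsAncestor.up_eq {p q : Q} (h : A.IsAncestor p q) {x : ℕ} (hx : 1 ≤ x)
    (hxp : x ≤ A.layer p) : A.up x p = A.up x q := by
  rw [← A.up_up hx hxp h.1, h.2]

theorem IsAncestor.trans {p q r : Q} (h : A.IsAncestor p q) (h' : A.IsAncestor q r) :
    A.IsAncestor p r :=
  ⟨h.1.trans h'.1, by rw [← h'.up_eq (A.one_le_layer p) h.1, h.2]⟩

theorem IsAncestor.eq {p q : Q} (h : A.IsAncestor p q) (hl : A.layer q ≤ A.layer p) : p = q := by
  rw [← h.2, le_antisymm h.1 hl, up_layer_self]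

/-- The ancestors of a state form a chain. -/
theorem IsAncestor.of_le {p q r : Q} (hp : A.IsAncestor p r) (hq : A.IsAncestor q r)
    (hl : A.layer p ≤ A.layer q) : A.IsAncestor p q :=
  ⟨hl, by rw [hq.up_eq (A.one_le_layer p) hl, hp.2]⟩

theorem IsAncestor.run {p q q' : Q} {l : List α} (h : A.IsAncestor p q)
    (hl : A.run q l = some q') : ∃ p', A.run p l = some p' ∧ A.IsAncestor p' q' := by
  refine ⟨A.up (A.layer p) q', ?_, isAncestor_up (A.one_le_layer p) ?_⟩
  · conv_lhs => rw [← h.2]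
    exact A.run_up (A.one_le_layer p) hl
  · rw [A.layer_run hl]; exact h.1

theorem IsAncestor.run_self {p q : Q} {l : List α} (h : A.IsAncestor p q)
    (hl : A.run q l = some q) : A.run p l = some p := by
  have := A.run_up (A.one_le_layer p) hl
  rwa [h.2] at this

variable (A)

/-! ### Infinite words and strong decision -/

/-- The infinite word `w` can be read from `q` inside the layer of `q`; a choice-free form of
membership in the infinite part of the safe language. -/
def Alive (q : Q) (w : ℕ → α) : Prop := ∀ n, (A.run q ((List.range n).map w)).isSome

variable {A}

theorem map_range_add (w : ℕ → α) (m n : ℕ) : (List.range (m + n)).map w =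
    (List.range m).map w ++ (List.range n).map fun i => w (m + i) := by
  rw [List.range_add, List.map_append, List.map_map]; rfl

theorem inr_mem_safeLang {x : ℕ} {q : Q} {w : ℕ → α} :
    Sum.inr w ∈ A.safeLang x q ↔ A.Alive (A.up x q) w := by
  constructor
  · rintro ⟨ρ, h₀, h⟩ n
    have : A.run (A.up x q) ((List.range n).map w) = some (ρ n) := by
      induction n with
      | zero => simp [h₀]
      | succ n ih =>
        rw [List.range_succ, List.map_append, A.run_append_of_run_eq_some ih]
        simp [run_singleton, h]
    rw [this]; rfl
  · intro h
    refine ⟨fun n => (A.run (A.up x q) ((List.range n).map w)).get (h n), rfl, fun i => ?_⟩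
    have h₁ : A.run (A.up x q) ((List.range i).map w) = some _ := (Option.some_get (h i)).symm
    have h₂ := A.run_append_of_run_eq_some h₁ [w i]
    rw [run_singleton] at h₂
    rw [← h₂]
    simp [List.range_succ]

theorem alive_of_run {q q' : Q} {w : ℕ → α} {n : ℕ} (h : A.Alive q w)
    (hn : A.run q ((List.range n).map w) = some q') : A.Alive q' fun i => w (n + i) := by
  intro m
  have := h (n + m)
  rwa [map_range_add, A.run_append_of_run_eq_some hn] at this

theorem stronglyDecided_iff {p : Q} {w : ℕ → α} : A.StronglyDecided p w ↔ A.Alive p w ∧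
    ∀ n c, A.layer c = A.layer p + 1 → A.run p ((List.range n).map w) = some (A.μ c) →
      ¬ A.Alive c fun i => w (n + i) := by
  unfold StronglyDecided
  rw [inr_mem_safeLang, up_layer_self]
  refine and_congr_right fun _ => forall_congr' fun n => ?_
  simp only [not_exists, not_and]
  refine forall_congr' fun c => forall_congr' fun hc => forall_congr' fun _ => ?_
  rw [inr_mem_safeLang, ← hc, up_layer_self]

theorem StronglyDecided.of_run {p p' : Q} {w : ℕ → α} {n : ℕ} (h : A.StronglyDecided p w)
    (hn : A.run p ((List.range n).map w) = some p') :
    A.StronglyDecided p' fun i => w (n + i) := by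
  rw [stronglyDecided_iff] at h ⊢
  refine ⟨alive_of_run h.1 hn, fun m c hc hm ha => h.2 (n + m) c ?_ ?_ ?_⟩
  · rw [hc, A.layer_run hn]
  · rw [map_range_add, A.run_append_of_run_eq_some hn, hm]
  · simpa only [add_assoc] using ha

variable (A)

/-- The words for which no state that is reachable together with a state of the first layer
strongly rejects a suffix. For a state `q` of the first layer of a consistent automaton this is a
description of the language of `q` without reference to games, see `mem_sem_lang_iff`. -/
def unrejected (q : Q) : Set (ℕ → α) :=
  {w | ¬ ∃ n p, A.run q ((List.range n).map w) = some (A.up 1 p) ∧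
    A.StronglyRejected p fun i => w (n + i)}

variable {A}

theorem Consistent.mem_unrejected_iff (hA : A.Consistent) {p : Q} {w : ℕ → α}
    (h : A.StronglyDecided p w) : w ∈ A.unrejected (A.up 1 p) ↔ Even (A.layer p) := by
  constructor
  · intro hw
    by_contra hp
    exact hw ⟨0, p, rfl, Nat.not_even_iff_odd.mp hp, by simpa using h⟩
  · rintro hp ⟨n, r, hr, hr'⟩
    rw [stronglyDecided_iff] at h
    obtain ⟨p', hp'⟩ := Option.isSome_iff_exists.mp (h.1 n)
    rw [← stronglyDecided_iff] at h
    refine hA ⟨p', r, _, ?_, ⟨?_, h.of_run hp'⟩, hr'⟩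
    · have := A.run_up le_rfl hp'
      rw [hr] at this
      exact (Option.some.inj this).symm
    · rwa [A.layer_run hp']

theorem unrejected_δ {q q' : Q} {a : α} (h : A.δ q a = some q') :
    A.unrejected q' = {w | (fun i => Nat.casesOn i a w) ∈ A.unrejected q} := by
  ext w
  have key : ∀ n, (List.range (n + 1)).map (fun i => (Nat.casesOn i a w : α)) =
      a :: (List.range n).map w := by
    intro n
    rw [add_comm, map_range_add]
    simp [add_comm 1]
  have key₂ : ∀ n, (fun i => (fun i => (Nat.casesOn i a w : α)) (n + 1 + i)) =
      fun i => w (n + i) := by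
    intro n; ext i; simp [show n + 1 + i = n + i + 1 by omega]
  have key₃ : ∀ n, A.run q ((List.range (n + 1)).map (fun i => (Nat.casesOn i a w : α))) =
      A.run q' ((List.range n).map w) := by
    intro n; rw [key, run_cons, h]; rfl
  simp only [unrejected, Set.mem_ofPred_eq]
  refine not_congr ⟨?_, ?_⟩
  · rintro ⟨n, p, h₁, h₂⟩
    exact ⟨n + 1, p, by rw [key₃, h₁], by rw [key₂]; exact h₂⟩
  · rintro ⟨n, p, h₁, h₂⟩
    cases n with
    | succ n => exact ⟨n, p, by rw [← key₃, h₁], by rw [key₂] at h₂; exact h₂⟩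
    | zero =>
      -- A rejecting state at position `0` is moved along the first letter.
      simp only [zero_add] at h₂
      obtain ⟨p', hp'⟩ := Option.isSome_iff_exists.mp ((stronglyDecided_iff.mp h₂.2).1 1)
      have h₃ := A.run_up le_rfl hp'
      have h₄ : q = A.up 1 p := by simpa using h₁
      rw [← h₄, key₃] at h₃
      refine ⟨0, p', h₃, by rw [A.layer_run hp']; exact h₂.1, ?_⟩
      have := h₂.2.of_run hp'
      have h₅ := key₂ 0
      simp only [zero_add] at h₅ ⊢
      rwa [h₅] at this

end Basic

section Game

variable {α : Type u} {Q : Type v} {A : LayeredAutomaton α Q}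

/-! ### The language without games -/

theorem le_actionLayer {x : ℕ} {q : Q} {a : α} (hx : x ≤ A.layer q)
    (h : (A.δ (A.up x q) a).isSome) : x ≤ A.actionLayer q a := by
  classical
  exact Nat.le_findGreatest hx h

theorem liminf_nat_spec {f : ℕ → ℕ} {d : ℕ} (hd : ∀ n, f n ≤ d) :
    ∃ N, (∀ n ≥ N, Filter.liminf f Filter.atTop ≤ f n) ∧
      ∀ m, ∃ n ≥ m, f n = Filter.liminf f Filter.atTop := by
  set S : Set ℕ := {a | ∀ᶠ n in Filter.atTop, a ≤ f n} with hS
  have hl : Filter.liminf f Filter.atTop = sSup S := Filter.liminf_eq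
  have hb : BddAbove S := ⟨d, fun a ha => by
    obtain ⟨n, hn⟩ := Filter.Eventually.exists ha
    exact hn.trans (hd n)⟩
  have hne : S.Nonempty := ⟨0, Filter.Eventually.of_forall fun n => Nat.zero_le _⟩
  have hmem : Filter.liminf f Filter.atTop ∈ S := hl ▸ Nat.sSup_mem hne hb
  have hsucc : Filter.liminf f Filter.atTop + 1 ∉ S := fun h => by
    have := le_csSup hb h
    omega
  obtain ⟨N, hN⟩ := Filter.eventually_atTop.mp hmem
  refine ⟨N, hN, fun m => ?_⟩
  by_contra! hm
  refine hsucc (Filter.eventually_atTop.mpr ⟨max N m, fun n hn => ?_⟩)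
  have h₁ := hN n (le_of_max_le_left hn)
  have h₂ := hm n (le_of_max_le_right hn)
  omega

theorem δ_up_of_step {q q' : A.Leaf} {a : α} (h : A.sem.step q a q') {y : ℕ} (hy : 1 ≤ y)
    (hya : y ≤ A.actionLayer q a) : y ≤ A.layer q' ∧ A.δ (A.up y q) a = some (A.up y q') := by
  obtain ⟨h₁, h₂⟩ := h
  refine ⟨hya.trans h₁, ?_⟩
  rw [← run_singleton] at h₂ ⊢
  have := A.run_up hy h₂
  rwa [A.up_up hy hya (A.actionLayer_le q a), A.up_up hy hya h₁] at this

/-- As long as the priorities of a run of the semantics automaton are at least `y`, the ancestors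
at layer `y` form a run of layer `y`. -/
theorem run_up_of_isRun {q : A.Leaf} {w : ℕ → α} {ρ : ℕ → A.Leaf} (hρ : A.sem.IsRun q w ρ)
    {y : ℕ} (hy : 1 ≤ y) (N n : ℕ)
    (h : ∀ i, N ≤ i → i < N + n → y ≤ A.actionLayer (ρ i) (w i)) :
    A.run (A.up y (ρ N)) ((List.range n).map fun i => w (N + i)) =
      some (A.up y (ρ (N + n))) := by
  induction n with
  | zero => rfl
  | succ n ih =>
    rw [List.range_succ, List.map_append,
      A.run_append_of_run_eq_some (ih fun i h₁ h₂ => h i h₁ (by omega))]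
    simp only [List.map_cons, List.map_nil, run_singleton]
    exact (δ_up_of_step (hρ.2 (N + n)) hy (h (N + n) (by omega) (by omega))).2

/-- `q'` is an optimal choice for the position `i + 1` of a play over `w` for the player who loses
if the `liminf` of the priorities is `x`: if possible, it lies below a state of layer `x + 1` from
which the rest of `w` is safe, and then no priority is `x` any more, unless a smaller one is
seen. -/
def IsSafeChoice (w : ℕ → α) (i x : ℕ) (q' : Q) : Prop :=
  ∀ c, A.layer c = x + 1 → A.μ c = A.up x q' → A.Alive c (fun j => w (i + 1 + j)) →
    x + 1 ≤ A.layer q' ∧ A.Alive (A.up (x + 1) q') fun j => w (i + 1 + j)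

theorem exists_safeChoice (w : ℕ → α) (i : ℕ) (q : A.Leaf) :
    ∃ q' : A.Leaf, A.sem.step q (w i) q' ∧
      A.IsSafeChoice w i (A.actionLayer q (w i)) q' := by
  set x := A.actionLayer q (w i) with hx
  have hx₁ : 1 ≤ x := A.one_le_actionLayer q (w i)
  by_cases h : ∃ c, A.layer c = x + 1 ∧ A.δ (A.up x q) (w i) = some (A.μ c) ∧
      A.Alive c fun j => w (i + 1 + j)
  · obtain ⟨c, hc, hcδ, hca⟩ := h
    obtain ⟨l, hl⟩ := A.exists_leaf c
    have hlc : A.up (x + 1) l = c := by rw [← hc]; exact hl.2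
    have hlx : x + 1 ≤ A.layer l := by rw [← hc]; exact hl.1
    have hlμ : A.up x l = A.μ c := by
      rw [← hl.up_eq hx₁ (by omega), A.up_of_layer_eq_succ hc]
    exact ⟨l, ⟨by omega, by rw [← hx, hcδ, hlμ]⟩, fun _ _ _ _ => ⟨hlx, by rwa [hlc]⟩⟩
  · obtain ⟨q', hq'⟩ := A.sem.complete q (w i)
    refine ⟨q', hq', fun c hc hcμ hca => (h ⟨c, hc, ?_, hca⟩).elim⟩
    rw [hcμ]; exact hq'.2

/-- If the player who loses a play makes a safe choice whenever the priority is the `liminf` of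
the priorities, then the state of that layer which is followed by the play from some point on
strongly decides the rest of the word. -/
theorem exists_stronglyDecided_of_isRun {q : A.Leaf} {w : ℕ → α} {ρ : ℕ → A.Leaf}
    (hρ : A.sem.IsRun q w ρ) {y : ℕ}
    (hy : y = Filter.liminf (fun i => A.sem.priority (ρ i) (w i)) Filter.atTop)
    (hsafe : ∀ i, A.actionLayer (ρ i) (w i) = y → A.IsSafeChoice w i y (ρ (i + 1)).1) :
    ∃ N p, A.run (A.up 1 q) ((List.range N).map w) = some (A.up 1 p) ∧ A.layer p = y ∧
      A.StronglyDecided p fun i => w (N + i) := by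
  obtain ⟨N, hN, hinf⟩ := liminf_nat_spec (f := fun i => A.sem.priority (ρ i) (w i))
    fun i => A.sem.priority_le _ _
  rw [← hy] at hN hinf
  replace hN : ∀ n ≥ N, y ≤ A.actionLayer (ρ n) (w n) := hN
  replace hinf : ∀ m, ∃ n ≥ m, A.actionLayer (ρ n) (w n) = y := hinf
  have hy₁ : 1 ≤ y := by
    obtain ⟨n, -, hn⟩ := hinf 0
    rw [← hn]; exact A.one_le_actionLayer _ _
  have hyl : ∀ n ≥ N, y ≤ A.layer (ρ n) := fun n hn => (hN n hn).trans (A.actionLayer_le _ _)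
  have hrun : ∀ n, A.run (A.up y (ρ N)) ((List.range n).map fun i => w (N + i)) =
      some (A.up y (ρ (N + n))) :=
    fun n => run_up_of_isRun hρ hy₁ N n fun i hi _ => hN i hi
  have hlp := A.layer_up y (ρ N) hy₁ (hyl N le_rfl)
  refine ⟨N, A.up y (ρ N), ?_, hlp, stronglyDecided_iff.mpr ⟨fun n => by rw [hrun]; rfl, ?_⟩⟩
  · have := run_up_of_isRun hρ le_rfl 0 N fun i _ _ => A.one_le_actionLayer _ _
    simp only [zero_add, hρ.1] at this
    rw [this, A.up_up le_rfl hy₁ (hyl N le_rfl)]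
  · intro n c hc hcrun hca
    rw [hlp] at hc
    rw [hrun] at hcrun
    replace hcrun := Option.some.inj hcrun
    obtain ⟨i, hi, hiy⟩ := hinf (N + n)
    -- Move the safe child `c` to the next position at which the priority is `y`.
    obtain ⟨k, rfl⟩ := Nat.exists_eq_add_of_le hi
    obtain ⟨c', hc'⟩ := Option.isSome_iff_exists.mp (hca (k + 1))
    have hca' := alive_of_run hca hc'
    have hcl' := A.layer_run hc'
    have hμ := A.run_μ (by omega) hc'
    have htrack := run_up_of_isRun hρ hy₁ (N + n) (k + 1) fun i hi _ => hN i (by omega)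
    simp only [← add_assoc] at hμ htrack hca'
    rw [← hcrun, htrack] at hμ
    replace hμ := (Option.some.inj hμ).symm
    have h₀ := hsafe _ hiy c' (by omega) hμ hca'
    have h₁ : ∀ m, y + 1 ≤ A.layer (ρ (N + n + k + 1 + m)) ∧
        A.Alive (A.up (y + 1) (ρ (N + n + k + 1 + m))) fun j => w (N + n + k + 1 + m + j) := by
      intro m
      induction m with
      | zero => exact h₀
      | succ m ih =>
        have h₂ := ih.2 1
        simp only [List.range_one, List.map_cons, List.map_nil, run_singleton, add_zero] at h₂
        obtain ⟨h₃, h₄⟩ := δ_up_of_step (hρ.2 _) (by omega) (le_actionLayer ih.1 h₂)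
        refine ⟨h₃, ?_⟩
        have := alive_of_run (n := 1) ih.2 (by
          simp only [List.range_one, List.map_cons, List.map_nil, run_singleton, add_zero]
          exact h₄)
        simpa only [← add_assoc] using this
    obtain ⟨j, hj, hjy⟩ := hinf (N + n + k + 1)
    obtain ⟨m, rfl⟩ := Nat.exists_eq_add_of_le hj
    have h₂ := (h₁ m).2 1
    simp only [List.range_one, List.map_cons, List.map_nil, run_singleton, add_zero] at h₂
    have := le_actionLayer (h₁ m).1 h₂
    omega

/-- Against every strategy of Eve there is a play in which Adam makes a safe choice at every even
priority. -/
theorem exists_isRun_follows (w : ℕ → α) (q : A.Leaf) {σ : List A.Leaf → A.Leaf → A.Leaf}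
    (hσ : A.sem.IsEveStrategy w σ) : ∃ ρ, A.sem.IsRun q w ρ ∧ A.sem.Follows w σ ρ ∧
      ∀ i, Even (A.actionLayer (ρ i) (w i)) →
        A.IsSafeChoice w i (A.actionLayer (ρ i) (w i)) (ρ (i + 1)).1 := by
  classical
  choose f hf hf' using exists_safeChoice (A := A) w
  -- A position of the play is stored together with the list of the preceding states.
  let next : List A.Leaf × A.Leaf → List A.Leaf × A.Leaf := fun s =>
    (s.1 ++ [s.2], if Odd (A.actionLayer s.2 (w s.1.length)) then σ s.1 s.2
      else f s.1.length s.2)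
  let s : ℕ → List A.Leaf × A.Leaf := fun n => next^[n] ([], q)
  have hs : ∀ n, s (n + 1) = next (s n) := fun n => Function.iterate_succ_apply' _ _ _
  have hlist : ∀ n, (s n).1 = (List.range n).map fun i => (s i).2 := by
    intro n
    induction n with
    | zero => rfl
    | succ n ih => rw [hs, List.range_succ, List.map_append, ← ih]; rfl
  have hlen : ∀ n, (s n).1.length = n := fun n => by rw [hlist]; simp
  have hodd : ∀ n, Odd (A.actionLayer (s n).2 (w n)) → (s (n + 1)).2 = σ (s n).1 (s n).2 := by
    intro n hn
    rw [hs]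
    simp only [next, hlen, if_pos hn]
  have heven : ∀ n, ¬ Odd (A.actionLayer (s n).2 (w n)) → (s (n + 1)).2 = f n (s n).2 := by
    intro n hn
    rw [hs]
    simp only [next, hlen, if_neg hn]
  refine ⟨fun n => (s n).2, ⟨rfl, fun i => ?_⟩, fun i hi => ?_, fun i hi => ?_⟩
  · by_cases h : Odd (A.actionLayer (s i).2 (w i))
    · show A.sem.step (s i).2 (w i) (s (i + 1)).2
      rw [hodd i h]
      have := hσ (s i).1 (s i).2
      rw [hlen] at this
      exact this h
    · show A.sem.step (s i).2 (w i) (s (i + 1)).2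
      rw [heven i h]
      exact hf i _
  · show (s (i + 1)).2 = _
    rw [hodd i hi, hlist]
  · show A.IsSafeChoice w i (A.actionLayer (s i).2 (w i)) (s (i + 1)).2.1
    rw [heven i (Nat.not_odd_iff_even.mpr hi)]
    exact hf' i _

/-- Both players can use safe choices as their strategy, and consistency makes exactly one of them
win. -/
theorem Consistent.mem_sem_lang_iff (hA : A.Consistent) {q : A.Leaf} {w : ℕ → α} :
    w ∈ A.sem.lang q ↔ w ∈ A.unrejected (A.up 1 q) := by
  constructor
  · rintro ⟨σ, hσ, hwin⟩ ⟨n, p, hp, hrej⟩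
    obtain ⟨ρ, hρ, hfol, hsafe⟩ := exists_isRun_follows w q hσ
    have hacc : Even (Filter.liminf (fun i => A.sem.priority (ρ i) (w i)) Filter.atTop) :=
      hwin ρ hρ hfol
    obtain ⟨N, r, hr, hry, hdec⟩ := exists_stronglyDecided_of_isRun hρ rfl fun i hi => by
      have := hsafe i (by rw [hi]; exact hacc)
      rwa [hi] at this
    rw [← hry] at hacc
    -- The two deciding states are compared at the maximum of the positions `n` and `N`.
    have move : ∀ {m k : ℕ} {t : Q}, A.run (A.up 1 q) ((List.range m).map w) = some (A.up 1 t) →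
        A.StronglyDecided t (fun i => w (m + i)) → ∃ t', A.layer t' = A.layer t ∧
        A.run (A.up 1 q) ((List.range (m + k)).map w) = some (A.up 1 t') ∧
        A.StronglyDecided t' fun i => w (m + k + i) := by
      intro m k t ht hd
      obtain ⟨t', ht'⟩ := Option.isSome_iff_exists.mp ((stronglyDecided_iff.mp hd).1 k)
      refine ⟨t', A.layer_run ht', ?_, ?_⟩
      · rw [map_range_add, A.run_append_of_run_eq_some ht, A.run_up le_rfl ht']
      · simpa only [← add_assoc] using hd.of_run ht'
    obtain ⟨p', hpl, hp', hpd⟩ := move (k := N) hp hrej.2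
    obtain ⟨r', hrl, hr', hrd⟩ := move (k := n) hr hdec
    rw [add_comm N n] at hr' hrd
    refine hA ⟨r', p', _, ?_, ⟨by rwa [hrl], hrd⟩, ⟨by rw [hpl]; exact hrej.1, hpd⟩⟩
    rw [hr'] at hp'
    exact Option.some.inj hp'
  · intro hw
    choose f hf hf' using exists_safeChoice (A := A) w
    refine ⟨fun h q => f h.length q, fun h q _ => hf _ _, fun ρ hρ hfol => ?_⟩
    by_contra hacc
    replace hacc := Nat.not_even_iff_odd.mp hacc
    obtain ⟨N, r, hr, hry, hdec⟩ := exists_stronglyDecided_of_isRun hρ rfl fun i hi => by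
      have h₁ : ρ (i + 1) = f i (ρ i) := by
        rw [hfol i (by rw [show A.sem.priority (ρ i) (w i) = _ from hi]; exact hacc)]
        simp
      have := hf' i (ρ i)
      rwa [hi, ← h₁] at this
    exact hw ⟨N, r, hr, by rw [hry]; exact hacc, hdec⟩

theorem Consistent.stateLang_eq (hA : A.Consistent) (p : Q) :
    A.stateLang p = A.unrejected (A.up 1 p) := by
  ext w
  constructor
  · rintro ⟨q, hq, hw⟩
    rwa [hA.mem_sem_lang_iff, ← hq.up_eq le_rfl (A.one_le_layer p)] at hw
  · intro hw
    obtain ⟨q, hq⟩ := A.exists_leaf p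
    refine ⟨q, hq, ?_⟩
    rwa [hA.mem_sem_lang_iff, ← hq.up_eq le_rfl (A.one_le_layer p)]

end Game

section Loops

variable {α : Type u} {Q : Type v} {A : LayeredAutomaton α Q}

/-! ### Purging words -/

/-- In a finite set with a transitive relation, every reflexive element is related to a recurrent
one. -/
theorem exists_recurrent {X : Type*} [Finite X] {R : X → X → Prop}
    (htrans : ∀ x y z, R x y → R y z → R x z) (hrefl : ∀ x y, R x y → R y y) {x : X}
    (hx : R x x) : ∃ y, R x y ∧ ∀ z, R y z → R z y := by
  obtain ⟨y, hy, hmin⟩ := (measure fun y => {z | R y z}.ncard).wf.has_min {y | R x y} ⟨x, hx⟩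
  refine ⟨y, hy, fun z hz => ?_⟩
  by_contra hzy
  refine hmin z (htrans _ _ _ hy hz) (Set.ncard_lt_ncard ?_ (Set.toFinite _))
  exact ⟨fun t ht => htrans _ _ _ hz ht, fun h => hzy (h (hrefl _ _ hy))⟩

variable (A) in
/-- After reading `k` only those runs survive that are at a state from which every word of `M` is
safe. -/
def Purges (M : Set (List α)) (k : List α) : Prop :=
  ∀ c c', A.run c k = some c' → ∀ u ∈ M, (A.run c' u).isSome

theorem Purges.append_left {M : Set (List α)} {k : List α} (h : A.Purges M k) (l : List α) :
    A.Purges M (l ++ k) := by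
  intro c c' hc
  rw [run_append, Option.bind_eq_some_iff] at hc
  obtain ⟨c₁, -, hc₁⟩ := hc
  exact h c₁ c' hc₁

theorem Purges.append_right {M : Set (List α)} (hM : ∀ u ∈ M, ∀ v ∈ M, u ++ v ∈ M) {k : List α}
    (h : A.Purges M k) {l : List α} (hl : l ∈ M) : A.Purges M (k ++ l) := by
  intro c c' hc u hu
  rw [run_append, Option.bind_eq_some_iff] at hc
  obtain ⟨c₁, hc₁, hc₂⟩ := hc
  have := h c c₁ hc₁ (l ++ u) (hM l hl u hu)
  rwa [A.run_append_of_run_eq_some hc₂] at this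

theorem exists_purges [Finite Q] {M : Set (List α)} (hM : ∀ u ∈ M, ∀ v ∈ M, u ++ v ∈ M)
    (hne : M.Nonempty) : ∃ k ∈ M, A.Purges M k := by
  -- A word after which as few runs as possible survive that can still be killed.
  let S : List α → Set Q := fun k => {c | ∃ c', A.run c k = some c' ∧ ∃ u ∈ M, A.run c' u = none}
  obtain ⟨k, hk, hmin⟩ := (measure fun k => (S k).ncard).wf.has_min M hne
  refine ⟨k, hk, fun c c' hc u hu => ?_⟩
  by_contra hcu
  rw [Option.not_isSome_iff_eq_none] at hcu
  refine hmin (k ++ u) (hM k hk u hu) (Set.ncard_lt_ncard ?_ (Set.toFinite _))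
  refine ⟨?_, fun h => ?_⟩
  · rintro e ⟨e', he, l, hl, hel⟩
    rw [run_append, Option.bind_eq_some_iff] at he
    obtain ⟨e₁, he₁, he₂⟩ := he
    exact ⟨e₁, he₁, u ++ l, hM u hu l hl, by rw [A.run_append_of_run_eq_some he₂, hel]⟩
  · obtain ⟨e', he, -⟩ := h (show c ∈ S k from ⟨c', hc, u, hu, hcu⟩)
    rw [A.run_append_of_run_eq_some hc, hcu] at he
    exact Option.some_ne_none _ he.symm

theorem exists_purges_both {Q' : Type w} {B : LayeredAutomaton α Q'} [Finite Q] [Finite Q']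
    {M : Set (List α)} (hM : ∀ u ∈ M, ∀ v ∈ M, u ++ v ∈ M) {u : List α} (hu : u ∈ M)
    (hu₀ : u ≠ []) : ∃ k ∈ M, k ≠ [] ∧ A.Purges M k ∧ B.Purges M k := by
  obtain ⟨k, hk, hkA⟩ := exists_purges (A := A) hM ⟨u, hu⟩
  obtain ⟨l, hl, hlB⟩ := exists_purges (A := B) hM ⟨u, hu⟩
  refine ⟨u ++ (k ++ l), hM _ hu _ (hM _ hk _ hl), ?_, ?_, ?_⟩
  · simp [hu₀]
  · exact (hkA.append_right hM hl).append_left u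
  · exact (hlB.append_left k).append_left u

/-- The infinite power of a non-empty word. -/
def omegaPow (k : List α) (hk : k ≠ []) (i : ℕ) : α :=
  k[i % k.length]'(Nat.mod_lt i (List.length_pos_iff.mpr hk))

theorem omegaPow_mul_add (k : List α) (hk : k ≠ []) (n i : ℕ) :
    omegaPow k hk (k.length * n + i) = omegaPow k hk i := by
  simp [omegaPow]

theorem map_range_omegaPow (k : List α) (hk : k ≠ []) :
    (List.range k.length).map (omegaPow k hk) = k := by
  refine List.ext_getElem (by simp) fun i h₁ h₂ => ?_
  simp [omegaPow, Nat.mod_eq_of_lt h₂]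

theorem run_omegaPow {p : Q} {k : List α} (hk : k ≠ []) (h : A.run p k = some p) (n : ℕ) :
    A.run p ((List.range (k.length * n)).map (omegaPow k hk)) = some p := by
  induction n with
  | zero => rfl
  | succ n ih =>
    rw [Nat.mul_succ, map_range_add, A.run_append_of_run_eq_some ih]
    simp only [omegaPow_mul_add]
    rw [map_range_omegaPow, h]

theorem le_length_mul {k : List α} (hk : k ≠ []) (n : ℕ) : n ≤ k.length * n :=
  Nat.le_mul_of_pos_left n (List.length_pos_iff.mpr hk)

theorem alive_omegaPow {p : Q} {k : List α} (hk : k ≠ []) (h : A.run p k = some p) :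
    A.Alive p (omegaPow k hk) := by
  intro n
  obtain ⟨m, hm⟩ := Nat.exists_eq_add_of_le (le_length_mul hk n)
  have := run_omegaPow hk h n
  rw [hm, map_range_add] at this
  obtain ⟨q, hq, -⟩ := A.exists_run_of_isSome_run_append (by rw [this]; rfl)
  rw [hq]; rfl

/-- If `k` is a purging word for a set of loops at `p`, then `p` strongly decides the infinite
power of `k` unless all these loops are safe from some child of `p`. -/
theorem stronglyDecided_omegaPow_or {p : Q} {M : Set (List α)}
    {k : List α} (hk : k ≠ []) (hp : A.run p k = some p) (hpurge : A.Purges M k) :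
    A.StronglyDecided p (omegaPow k hk) ∨
      ∃ c, A.layer c = A.layer p + 1 ∧ A.μ c = p ∧ ∀ u ∈ M, (A.run c u).isSome := by
  by_contra! hcon
  refine hcon.1 (stronglyDecided_iff.mpr ⟨alive_omegaPow hk hp, fun n c hc hn ha => ?_⟩)
  have hc₁ := A.one_le_layer p
  have child : ∀ {m : ℕ} {c c' : Q} {l : List α}, A.layer c = A.layer p + 1 →
      A.run p ((List.range m).map (omegaPow k hk)) = some (A.μ c) → A.run c l = some c' →
      A.run p ((List.range m).map (omegaPow k hk) ++ l) = some (A.μ c') := by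
    intro m c c' l hc hm hl
    rw [A.run_append_of_run_eq_some hm, A.run_μ (by omega) hl]
  -- The safe child is moved to the end of a copy of `k`, and then read over another copy.
  obtain ⟨m, hm⟩ := Nat.exists_eq_add_of_le (le_length_mul hk n)
  obtain ⟨c₁, hcm⟩ := Option.isSome_iff_exists.mp (ha m)
  have ha₁ := alive_of_run ha hcm
  have h₁ := child hc hn hcm
  rw [← map_range_add, ← hm, run_omegaPow hk hp] at h₁
  simp only [← add_assoc, ← hm, omegaPow_mul_add] at ha₁
  have hl₁ := A.layer_run hcm
  obtain ⟨c₂, hc₂⟩ := Option.isSome_iff_exists.mp (ha₁ k.length)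
  rw [map_range_omegaPow] at hc₂
  have h₂ := A.run_μ (by omega) hc₂
  rw [← Option.some.inj h₁, hp] at h₂
  obtain ⟨u, hu, hu'⟩ := hcon.2 c₂ (by rw [A.layer_run hc₂]; omega) (Option.some.inj h₂).symm
  exact hu' (hpurge c₁ c₂ hc₂ u hu)

end Loops

section Simulation

variable {α : Type u} {QL : Type w} {Q : Type v} {AL : LayeredAutomaton α QL}
  {A : LayeredAutomaton α Q}

/-! ### Recurrent simulations -/

variable (AL A) in
/-- Every finite word that can be read from `p` in its layer can be read from `r` in its layer. -/
def SafeLE (p : QL) (r : Q) : Prop := ∀ u, (AL.run p u).isSome → (A.run r u).isSome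

theorem SafeLE.trans {Q' : Type*} {B : LayeredAutomaton α Q'} {p : QL} {q : Q} {r : Q'}
    (h : SafeLE AL A p q) (h' : SafeLE A B q r) : SafeLE AL B p r :=
  fun u hu => h' u (h u hu)

theorem safeLE_μ {q : Q} (hq : 2 ≤ A.layer q) : SafeLE A A q (A.μ q) := by
  intro u hu
  obtain ⟨q', hq'⟩ := Option.isSome_iff_exists.mp hu
  rw [A.run_μ hq hq']; rfl

theorem SafeLE.run {p p' : QL} {r r' : Q} {u : List α} (h : SafeLE AL A p r)
    (hp : AL.run p u = some p') (hr : A.run r u = some r') : SafeLE AL A p' r' := by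
  intro v hv
  have := h (u ++ v) (by rwa [AL.run_append_of_run_eq_some hp])
  rwa [A.run_append_of_run_eq_some hr] at this

theorem SafeLE.exists_run {p p' : QL} {r : Q} {u : List α} (h : SafeLE AL A p r)
    (hp : AL.run p u = some p') : ∃ r', A.run r u = some r' :=
  Option.isSome_iff_exists.mp (h u (by rw [hp]; rfl))

theorem safeLang_subset_of_safeLE {p q : Q} (hpq : A.layer p = A.layer q)
    (h : SafeLE A A p q) : A.safeLang (A.layer p) p ⊆ A.safeLang (A.layer p) q := by
  rintro (u | w) hu
  · simp only [safeLang, Set.mem_ofPred_eq, up_layer_self] at hu ⊢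
    rw [hpq, up_layer_self]
    exact h u hu
  · rw [inr_mem_safeLang, up_layer_self] at hu
    rw [inr_mem_safeLang, hpq, up_layer_self]
    exact fun n => h _ (hu n)

theorem Consistent.eq_of_safeLE (hA : A.Consistent) (hmin : A.SafeMinimal) {p q : Q}
    (hp : 2 ≤ A.layer p) (hpq : A.layer p = A.layer q) (hμ : A.μ p = A.μ q)
    (h : SafeLE A A p q) (h' : SafeLE A A q p) : p = q := by
  have hup : ∀ y, y < A.layer p → A.up y p = A.up y q := by
    intro y hy
    rw [← A.up_μ hp hy, hμ, A.up_μ (by omega) (by omega)]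
  refine hmin (A.layer p) p q rfl hpq.symm ⟨?_, fun y _ hyp => ?_⟩
  · rw [hA.stateLang_eq, hA.stateLang_eq, hup 1 (by omega)]
  · rcases hyp.lt_or_eq with hlt | rfl
    · unfold safeLang
      rw [hup y hlt]
    · refine Set.Subset.antisymm (safeLang_subset_of_safeLE hpq h) ?_
      rw [hpq]
      exact safeLang_subset_of_safeLE hpq.symm h'

variable (AL A) in
/-- The pair `y` is reached from the pair `x` by reading a common word in both components, and then
possibly descending in the second component to a state that still allows all the words which are
safe from the first one. -/
def SimReach (x y : QL × Q) : Prop :=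
  ∃ u r, AL.run x.1 u = some y.1 ∧ A.run x.2 u = some r ∧ A.IsAncestor r y.2 ∧
    SafeLE AL A y.1 y.2

variable (AL A) in
/-- `r` allows all the words that are safe from `p`, and the pair is recurrent for `SimReach`. In
particular no child of `r` allows all the words that are safe from `p`. -/
def IsRecurrent (p : QL) (r : Q) : Prop :=
  SafeLE AL A p r ∧ ∀ y, SimReach AL A (p, r) y → SimReach AL A y (p, r)

theorem SimReach.trans {x y z : QL × Q} (h : SimReach AL A x y) (h' : SimReach AL A y z) :
    SimReach AL A x z := by
  obtain ⟨u, r, h₁, h₂, h₃, -⟩ := h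
  obtain ⟨u', r', h₁', h₂', h₃', h₄'⟩ := h'
  obtain ⟨s, hs, hs'⟩ := h₃.run h₂'
  exact ⟨u ++ u', s, by rw [AL.run_append_of_run_eq_some h₁, h₁'],
    by rw [A.run_append_of_run_eq_some h₂, hs], hs'.trans h₃', h₄'⟩

theorem SafeLE.simReach {p : QL} {r r' : Q} (h : A.IsAncestor r r') (h' : SafeLE AL A p r') :
    SimReach AL A (p, r) (p, r') := ⟨[], r, rfl, rfl, h, h'⟩

theorem SimReach.layer_le {x y : QL × Q} (h : SimReach AL A x y) :
    A.layer x.2 ≤ A.layer y.2 := by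
  obtain ⟨u, r, -, h₂, h₃, -⟩ := h
  rw [← A.layer_run h₂]
  exact h₃.1

theorem IsRecurrent.of_simReach {p : QL} {r : Q} {y : QL × Q} (h : IsRecurrent AL A p r)
    (hy : SimReach AL A (p, r) y) : IsRecurrent AL A y.1 y.2 :=
  ⟨hy.choose_spec.choose_spec.2.2.2, fun _ hz => (h.2 _ (hy.trans hz)).trans hy⟩

theorem IsRecurrent.layer_le {p : QL} {r : Q} {y : QL × Q} (h : IsRecurrent AL A p r)
    (hy : SimReach AL A (p, r) y) : A.layer y.2 ≤ A.layer r := (h.2 y hy).layer_le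

theorem IsRecurrent.eq_of_isAncestor {p : QL} {r r' : Q} (h : IsRecurrent AL A p r)
    (hr : A.IsAncestor r r') (hr' : SafeLE AL A p r') : r = r' :=
  hr.eq (h.layer_le (hr'.simReach hr))

theorem IsRecurrent.not_safeLE_child {p : QL} {r c : Q} (h : IsRecurrent AL A p r)
    (hc : A.layer c = A.layer r + 1) (hμ : A.μ c = r) : ¬ SafeLE AL A p c := by
  intro hpc
  have h₁ := A.one_le_layer r
  have := h.eq_of_isAncestor (hμ ▸ isAncestor_μ (by omega)) hpc
  rw [this] at hc
  omega

theorem IsRecurrent.simReach_of_run {p p' : QL} {r r' : Q} {u : List α}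
    (h : IsRecurrent AL A p r) (hp : AL.run p u = some p') (hr : A.run r u = some r') :
    SimReach AL A (p, r) (p', r') :=
  ⟨u, r', hp, hr, A.isAncestor_refl r', h.1.run hp hr⟩

theorem IsRecurrent.of_run {p p' : QL} {r r' : Q} {u : List α} (h : IsRecurrent AL A p r)
    (hp : AL.run p u = some p') (hr : A.run r u = some r') : IsRecurrent AL A p' r' :=
  h.of_simReach (h.simReach_of_run hp hr)

/-- A recurrent pair is recurrent for the reading of letters alone. -/
theorem IsRecurrent.exists_return {p p' : QL} {r r' : Q} {u : List α}
    (h : IsRecurrent AL A p r) (hp : AL.run p u = some p') (hr : A.run r u = some r') :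
    ∃ v, AL.run p' v = some p ∧ A.run r' v = some r := by
  obtain ⟨v, s, h₁, h₂, h₃, -⟩ := h.2 _ (h.simReach_of_run hp hr)
  refine ⟨v, h₁, ?_⟩
  dsimp only at h₂ h₃
  rw [h₂, h₃.eq (by rw [A.layer_run h₂, A.layer_run hr])]

theorem IsRecurrent.exists_loop {p : QL} {r : Q} {u : List α} (h : IsRecurrent AL A p r)
    (hu : (AL.run p u).isSome) :
    ∃ v, AL.run p (u ++ v) = some p ∧ A.run r (u ++ v) = some r := by
  obtain ⟨p', hp'⟩ := Option.isSome_iff_exists.mp hu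
  obtain ⟨r', hr'⟩ := h.1.exists_run hp'
  obtain ⟨v, hv, hv'⟩ := h.exists_return hp' hr'
  exact ⟨v, by rw [AL.run_append_of_run_eq_some hp', hv],
    by rw [A.run_append_of_run_eq_some hr', hv']⟩

theorem IsRecurrent.safeLE_of_loops {Q' : Type*} {B : LayeredAutomaton α Q'} {p : QL} {r : Q}
    {c : Q'} (h : IsRecurrent AL A p r)
    (hc : ∀ u, AL.run p u = some p → A.run r u = some r → (B.run c u).isSome) :
    SafeLE AL B p c := by
  intro u hu
  obtain ⟨v, hv, hv'⟩ := h.exists_loop hu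
  obtain ⟨c', hc', -⟩ := B.exists_run_of_isSome_run_append (hc _ hv hv')
  rw [hc']; rfl

theorem IsRecurrent.exists_nonempty_loop (hnorm : AL.Normal) {p : QL} {r : Q}
    (h : IsRecurrent AL A p r) (hp : 2 ≤ AL.layer p) :
    ∃ u, u ≠ [] ∧ AL.run p u = some p ∧ A.run r u = some r := by
  obtain ⟨v, hv, hvp⟩ := (hnorm p hp).1 [] p rfl
  obtain ⟨t, ht, ht'⟩ := h.exists_loop (u := v) (by rw [hvp]; rfl)
  exact ⟨v ++ t, by simp [hv], ht, ht'⟩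

theorem even_layer_iff (hAL : AL.Consistent) (hA : A.Consistent) {p : QL} {r : Q} {w : ℕ → α}
    (hlang : AL.unrejected (AL.up 1 p) = A.unrejected (A.up 1 r)) (hp : AL.StronglyDecided p w)
    (hr : A.StronglyDecided r w) : Even (AL.layer p) ↔ Even (A.layer r) := by
  rw [← hAL.mem_unrejected_iff hp, ← hA.mem_unrejected_iff hr, hlang]

/-- The components of a recurrent pair strongly decide a common word. -/
theorem IsRecurrent.even_layer_iff [Finite QL] [Finite Q] (hAL : AL.Consistent)
    (hA : A.Consistent) (hnorm : AL.Normal) {p : QL} {r : Q} (h : IsRecurrent AL A p r)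
    (hp : 2 ≤ AL.layer p) (hlang : AL.unrejected (AL.up 1 p) = A.unrejected (A.up 1 r)) :
    Even (AL.layer p) ↔ Even (A.layer r) := by
  obtain ⟨u, hu₀, hu⟩ := h.exists_nonempty_loop hnorm hp
  let M : Set (List α) := {u | AL.run p u = some p ∧ A.run r u = some r}
  obtain ⟨k, hkM, hk, hkL, hkA⟩ := exists_purges_both (A := AL) (B := A) (M := M)
    (fun u hu v hv => ⟨by rw [AL.run_append_of_run_eq_some hu.1, hv.1],
      by rw [A.run_append_of_run_eq_some hu.2, hv.2]⟩) hu hu₀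
  rcases stronglyDecided_omegaPow_or hk hkM.1 hkL with hdp | ⟨c, hc, hμ, hcM⟩
  · rcases stronglyDecided_omegaPow_or hk hkM.2 hkA with hdr | ⟨c, hc, hμ, hcM⟩
    · exact LayeredAutomaton.even_layer_iff hAL hA hlang hdp hdr
    · exact (h.not_safeLE_child hc hμ (h.safeLE_of_loops fun u h₁ h₂ => hcM u ⟨h₁, h₂⟩)).elim
  · obtain ⟨u, hu, hu'⟩ := (hnorm p hp).2 c (by omega) hμ
    have := h.safeLE_of_loops (fun u h₁ h₂ => hcM u ⟨h₁, h₂⟩) u hu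
    rw [hu'] at this
    exact (Bool.false_ne_true this).elim

/-- If a sibling `c` of `p` that is maximal for `SafeLE` allows all words of a monoid `M` which
contains the loops at the recurrent pair of `p` and `r`, then `p` itself allows them: by maximality
and safe minimality some word leads both from `p` to `c` and from `c` to `c`, so that `M` can be
read from `c` after a detour which belongs to `M` and ends in `p`. -/
theorem IsRecurrent.run_isSome_of_maximal (hAL : AL.Consistent) (hmin : AL.SafeMinimal)
    (hcentr : AL.Centralised) {p c : QL} {r : Q} (h : IsRecurrent AL A p r)
    (hp : 2 ≤ AL.layer p) (hcp : AL.layer c = AL.layer p) (hμ : AL.μ c = AL.μ p)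
    {M : Set (List α)} (hM : ∀ u ∈ M, ∀ v ∈ M, u ++ v ∈ M)
    (hloop : ∀ u, AL.run p u = some p → A.run r u = some r → u ∈ M)
    (hcM : ∀ u ∈ M, (AL.run c u).isSome)
    (hmax : ∀ c', AL.layer c' = AL.layer p → AL.μ c' = AL.μ p → SafeLE AL AL c c' →
      SafeLE AL AL c' c) : ∀ u ∈ M, (AL.run p u).isSome := by
  have hpc : SafeLE AL AL p c := h.safeLE_of_loops fun u h₁ h₂ => hcM u (hloop u h₁ h₂)
  obtain ⟨⟨v, hv⟩, -⟩ := hcentr (AL.layer p) p c hp rfl hcp hμ.symm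
    (safeLang_subset_of_safeLE hcp.symm hpc)
  obtain ⟨r', hr'⟩ := h.1.exists_run hv
  obtain ⟨t, ht, ht'⟩ := h.exists_return hv hr'
  -- The word `v` leads from `p` to `c`; by maximality it also leads from `c` to `c`.
  obtain ⟨c', hc'⟩ := hpc.exists_run hv
  have hcl : AL.layer c' = AL.layer p := by rw [AL.layer_run hc', hcp]
  have hcμ : AL.μ c' = AL.μ p := by
    have h₁ := AL.run_μ (by omega) hc'
    rw [hμ, AL.run_μ hp hv, hμ] at h₁
    exact (Option.some.inj h₁).symm
  have hcc' : SafeLE AL AL c c' := by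
    refine (h.of_run hv hr').safeLE_of_loops fun u h₁ h₂ => ?_
    have := hcM (v ++ (u ++ t)) (hloop _ ?_ ?_)
    · rw [AL.run_append_of_run_eq_some hc'] at this
      obtain ⟨e, he, -⟩ := AL.exists_run_of_isSome_run_append this
      rw [he]; rfl
    · rw [AL.run_append_of_run_eq_some hv, AL.run_append_of_run_eq_some h₁, ht]
    · rw [A.run_append_of_run_eq_some hr', A.run_append_of_run_eq_some h₂, ht']
  have hcc : c = c' := hAL.eq_of_safeLE hmin (by omega) (by omega) (by rw [hμ, hcμ]) hcc'
    (hmax c' hcl hcμ hcc')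
  rw [← hcc] at hc'
  intro u hu
  have := hcM (v ++ t ++ u) (hM _ (hloop _ ?_ ?_) _ hu)
  · rwa [List.append_assoc, AL.run_append_of_run_eq_some hc', AL.run_append_of_run_eq_some ht]
      at this
  · rw [AL.run_append_of_run_eq_some hv, ht]
  · rw [A.run_append_of_run_eq_some hr', ht']

/-- Two siblings of the canonical automaton that form recurrent pairs with comparable states of
`A` coincide. A word that mixes the loops of both pairs is strongly decided in `A`, hence it is not
strongly decided by the parent of the siblings, hence it is safe from one of its children. -/
theorem IsRecurrent.eq_of_isAncestor_of_μ_eq [Finite QL] [Finite Q] (hAL : AL.Consistent)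
    (hA : A.Consistent) (hnorm : AL.Normal) (hmin : AL.SafeMinimal) (hcentr : AL.Centralised)
    {p q : QL} {r s : Q} (hr : IsRecurrent AL A p r) (hs : IsRecurrent AL A q s)
    (hp : 2 ≤ AL.layer p) (hpq : AL.layer p = AL.layer q) (hμ : AL.μ p = AL.μ q)
    (hrs : A.IsAncestor r s) (hlang : AL.unrejected (AL.up 1 p) = A.unrejected (A.up 1 r)) :
    p = q ∧ r = s := by
  have hlμ := AL.layer_μ p hp
  let M : Set (List α) := {u | A.run r u = some r ∧ AL.run (AL.μ p) u = some (AL.μ p)}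
  have hM : ∀ u ∈ M, ∀ v ∈ M, u ++ v ∈ M := fun u hu v hv =>
    ⟨by rw [A.run_append_of_run_eq_some hu.1, hv.1],
      by rw [AL.run_append_of_run_eq_some hu.2, hv.2]⟩
  have hpM : ∀ u, AL.run p u = some p → A.run r u = some r → u ∈ M :=
    fun u h₁ h₂ => ⟨h₂, AL.run_μ hp h₁⟩
  have hqM : ∀ u, AL.run q u = some q → A.run s u = some s → u ∈ M :=
    fun u h₁ h₂ => ⟨hrs.run_self h₂, by rw [hμ]; exact AL.run_μ (by omega) h₁⟩
  obtain ⟨u, hu₀, hup, hur⟩ := hr.exists_nonempty_loop hnorm hp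
  obtain ⟨k, hkM, hk, hkL, hkA⟩ := exists_purges_both (A := AL) (B := A) hM (hpM u hup hur) hu₀
  have hdr : A.StronglyDecided r (omegaPow k hk) := by
    refine (stronglyDecided_omegaPow_or hk hkM.1 hkA).resolve_right ?_
    rintro ⟨c, hc, hcr, hcM⟩
    exact hr.not_safeLE_child hc hcr (hr.safeLE_of_loops fun u h₁ h₂ => hcM u (hpM u h₁ h₂))
  have hex : ∃ c, AL.layer c = AL.layer p ∧ AL.μ c = AL.μ p ∧ ∀ u ∈ M, (AL.run c u).isSome := by
    rcases stronglyDecided_omegaPow_or hk hkM.2 hkL with hd | ⟨c, hc, h⟩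
    · have h₁ := LayeredAutomaton.even_layer_iff hAL hA
        (by rw [AL.up_μ hp (by omega), hlang]) hd hdr
      rw [← hr.even_layer_iff hAL hA hnorm hp hlang, ← hlμ, Nat.even_add_one] at h₁
      exact (iff_not_self h₁).elim
    · exact ⟨c, by omega, h⟩
  obtain ⟨c₀, hc₀⟩ := hex
  -- A child of the parent of `p` which allows `M` and is maximal for `SafeLE`.
  obtain ⟨c, ⟨-, ⟨hcl, hcμ, hcM⟩, -⟩, hmax⟩ := exists_recurrent (x := c₀)
    (R := fun c c' => (AL.layer c = AL.layer p ∧ AL.μ c = AL.μ p ∧ ∀ u ∈ M, (AL.run c u).isSome) ∧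
      (AL.layer c' = AL.layer p ∧ AL.μ c' = AL.μ p ∧ ∀ u ∈ M, (AL.run c' u).isSome) ∧
      SafeLE AL AL c c')
    (fun x y z h h' => ⟨h.1, h'.2.1, h.2.2.trans h'.2.2⟩)
    (fun x y h => ⟨h.2.1, h.2.1, fun _ => id⟩) ⟨hc₀, hc₀, fun _ => id⟩
  have hmax' : ∀ c', AL.layer c' = AL.layer p → AL.μ c' = AL.μ p → SafeLE AL AL c c' →
      SafeLE AL AL c' c := fun c' h₁ h₂ h₃ =>
    (hmax c' ⟨⟨hcl, hcμ, hcM⟩, ⟨h₁, h₂, fun u hu => h₃ u (hcM u hu)⟩, h₃⟩).2.2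
  have h₁ := hr.run_isSome_of_maximal hAL hmin hcentr hp hcl hcμ hM hpM hcM hmax'
  have h₂ := hs.run_isSome_of_maximal hAL hmin hcentr (by omega) (by omega) (by rw [hcμ, hμ]) hM
    hqM hcM (by rwa [← hpq, ← hμ])
  have hpq' : p = q := hAL.eq_of_safeLE hmin hp hpq hμ
    (hr.safeLE_of_loops fun u h h' => h₂ u (hpM u h h'))
    (hs.safeLE_of_loops fun u h h' => h₁ u (hqM u h h'))
  subst hpq'
  exact ⟨rfl, hr.eq_of_isAncestor hrs hs.1⟩

end Simulation

section Representation

variable {α : Type u} {QL : Type w} {Q : Type v} {AL : LayeredAutomaton α QL}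
  {A : LayeredAutomaton α Q}

/-! ### States representing the states of the canonical automaton -/

variable (AL A) in
/-- The state `r` of `A` can play the role of the state `p` of `AL`: in the first layer this means
that the languages agree; in a layer `x ≥ 2` the pair has to be recurrent and `r` has to lie below
a state that plays the role of the parent of `p`. The layers of `p` and `r` may differ. -/
inductive Represents : QL → Q → Prop
  | base {p : QL} {r : Q} (hp : AL.layer p = 1) (hr : A.layer r = 1)
      (h : AL.unrejected p = A.unrejected r) : Represents p r
  | step {p : QL} {r' r : Q} (hp : 2 ≤ AL.layer p) (h : Represents (AL.μ p) r')
      (hr : A.IsAncestor r' r) (hrec : IsRecurrent AL A p r) : Represents p r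

theorem up_one_of_layer_eq_one {q : Q} (hq : A.layer q = 1) : A.up 1 q = q := by
  rw [← hq, up_layer_self]

theorem exists_run_of_layer_eq_one {q : Q} (hq : A.layer q = 1) (u : List α) :
    ∃ q', A.run q u = some q' := by
  induction u generalizing q with
  | nil => exact ⟨q, rfl⟩
  | cons a u ih =>
    obtain ⟨q₁, h₁⟩ := Option.isSome_iff_exists.mp (A.complete_one q a hq)
    obtain ⟨q', hq'⟩ := ih (by rw [A.layer_δ _ _ _ h₁, hq])
    exact ⟨q', by rw [run_cons, h₁]; exact hq'⟩

theorem unrejected_eq_of_run {p p' : QL} {r r' : Q} {u : List α}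
    (h : AL.unrejected p = A.unrejected r) (hp : AL.run p u = some p') (hr : A.run r u = some r') :
    AL.unrejected p' = A.unrejected r' := by
  induction u generalizing p r with
  | nil =>
    rw [run_nil, Option.some.injEq] at hp hr
    rwa [← hp, ← hr]
  | cons a u ih =>
    rw [run_cons, Option.bind_eq_some_iff] at hp hr
    obtain ⟨p₁, hp₁, hp₂⟩ := hp
    obtain ⟨r₁, hr₁, hr₂⟩ := hr
    exact ih (by rw [unrejected_δ hp₁, unrejected_δ hr₁, h]) hp₂ hr₂

theorem Represents.unrejected_eq {p : QL} {r : Q} (h : Represents AL A p r) :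
    AL.unrejected (AL.up 1 p) = A.unrejected (A.up 1 r) := by
  induction h with
  | base hp hr h => rwa [up_one_of_layer_eq_one hp, up_one_of_layer_eq_one hr]
  | step hp _ hr _ ih =>
    rwa [AL.up_μ hp (by omega), hr.up_eq le_rfl (A.one_le_layer _)] at ih

theorem Represents.layer_eq_one {p : QL} {r : Q} (h : Represents AL A p r)
    (hp : AL.layer p = 1) : A.layer r = 1 := by
  cases h with
  | base _ hr _ => exact hr
  | step hp' _ _ _ => omega

theorem Represents.isRecurrent {p : QL} {r : Q} (h : Represents AL A p r)
    (hp : 2 ≤ AL.layer p) : IsRecurrent AL A p r := by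
  cases h with
  | base hp' _ _ => omega
  | step _ _ _ hrec => exact hrec

theorem Represents.exists_parent {p : QL} {r : Q} (h : Represents AL A p r)
    (hp : 2 ≤ AL.layer p) : ∃ r', Represents AL A (AL.μ p) r' ∧ A.IsAncestor r' r := by
  cases h with
  | base hp' _ _ => omega
  | step _ h hr _ => exact ⟨_, h, hr⟩

theorem Represents.safeLE {p : QL} {r : Q} (h : Represents AL A p r) : SafeLE AL A p r := by
  cases h with
  | base _ hr _ =>
    intro u _
    obtain ⟨r', hr'⟩ := exists_run_of_layer_eq_one hr u
    rw [hr']; rfl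
  | step _ _ _ hrec => exact hrec.1

theorem Represents.of_run {p p' : QL} {r r' : Q} {u : List α} (h : Represents AL A p r)
    (hp : AL.run p u = some p') (hr : A.run r u = some r') : Represents AL A p' r' := by
  induction h generalizing p' r' with
  | base hp' hr' h =>
    exact .base (by rw [AL.layer_run hp, hp']) (by rw [A.layer_run hr, hr'])
      (unrejected_eq_of_run h hp hr)
  | step hp' _ hanc hrec ih =>
    obtain ⟨s, hs, hs'⟩ := hanc.run hr
    exact .step (by rw [AL.layer_run hp]; exact hp') (ih (AL.run_μ hp' hp) hs) hs'
      (hrec.of_run hp hr)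

theorem Represents.even_layer_iff [Finite QL] [Finite Q] (hAL : AL.Consistent)
    (hA : A.Consistent) (hnorm : AL.Normal) {p : QL} {r : Q} (h : Represents AL A p r) :
    Even (AL.layer p) ↔ Even (A.layer r) := by
  rcases (AL.one_le_layer p).eq_or_lt with hp | hp
  · rw [h.layer_eq_one hp.symm, ← hp]
  · exact (h.isRecurrent hp).even_layer_iff hAL hA hnorm hp h.unrejected_eq

/-- The state representing the parent is a proper ancestor, for a reason of parity. -/
theorem Represents.layer_ne [Finite QL] [Finite Q] (hAL : AL.Consistent)
    (hA : A.Consistent) (hnorm : AL.Normal) {p : QL} {r r' : Q} (h : Represents AL A p r)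
    (hp : 2 ≤ AL.layer p) (h' : Represents AL A (AL.μ p) r') : A.layer r' ≠ A.layer r := by
  intro heq
  have h₁ := h.even_layer_iff hAL hA hnorm
  rw [← heq, ← h'.even_layer_iff hAL hA hnorm, ← AL.layer_μ p hp, Nat.even_add_one] at h₁
  exact not_iff_self h₁

/-- Starting below a representative of the parent of `p`, one reaches a representative of `p`. -/
theorem Represents.exists_child [Finite QL] [Finite Q] (hnorm : AL.Normal) {p : QL} {r : Q}
    (hp : 2 ≤ AL.layer p) (h : Represents AL A (AL.μ p) r) : ∃ s, Represents AL A p s := by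
  have hpr : SafeLE AL A p r := (safeLE_μ hp).trans h.safeLE
  obtain ⟨⟨q, s⟩, hqs, hrec⟩ := exists_recurrent (R := SimReach AL A) (x := (p, r))
    (fun _ _ _ h h' => h.trans h')
    (fun x y h => SafeLE.simReach (A.isAncestor_refl _) h.choose_spec.choose_spec.2.2.2)
    (hpr.simReach (A.isAncestor_refl r))
  obtain ⟨u, r', hu, hr', hanc, hle⟩ := hqs
  dsimp only at hu hr' hanc hle
  have hqs : Represents AL A q s := .step (by rw [AL.layer_run hu]; exact hp)
    (h.of_run (AL.run_μ hp hu) hr') hanc ⟨hle, hrec⟩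
  obtain ⟨v, -, hv⟩ := (hnorm p hp).1 u q hu
  obtain ⟨s', hs'⟩ := hle.exists_run hv
  exact ⟨s', hqs.of_run hv hs'⟩

theorem exists_represents [Finite QL] [Finite Q] (hnorm : AL.Normal)
    (hinit : Represents AL A AL.init A.init) (p : QL) : ∃ r, Represents AL A p r := by
  obtain ⟨n, hn⟩ : ∃ n, AL.layer p = n + 1 := ⟨AL.layer p - 1, by have := AL.one_le_layer p; omega⟩
  induction n generalizing p with
  | zero =>
    obtain ⟨u, hu⟩ := AL.reachable_one p hn
    obtain ⟨r, hr⟩ := exists_run_of_layer_eq_one A.layer_init u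
    exact ⟨r, hinit.of_run hu hr⟩
  | succ n ih =>
    have hp : 2 ≤ AL.layer p := by omega
    have := AL.layer_μ p hp
    obtain ⟨r, hr⟩ := ih (AL.μ p) (by omega)
    exact hr.exists_child hnorm hp

/-- Representatives with a common descendant of two states of the same layer coincide, and so do
the states that they represent. -/
theorem Represents.eq_of_isAncestor [Finite QL] [Finite Q] (hAL : AL.Consistent)
    (hA : A.Consistent) (hnorm : AL.Normal) (hmin : AL.SafeMinimal) (hcentr : AL.Centralised)
    {p q : QL} {r s l : Q} (hr : Represents AL A p r) (hs : Represents AL A q s)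
    (hrl : A.IsAncestor r l) (hsl : A.IsAncestor s l) (hpq : AL.layer p = AL.layer q) :
    p = q ∧ r = s := by
  induction hr generalizing q s with
  | @base p r hp hr h =>
    have hs₁ := hs.layer_eq_one (hpq ▸ hp)
    have hrs : r = s := by rw [← hrl.2, ← hsl.2, hr, hs₁]
    refine ⟨hmin 1 p q hp (by omega) ⟨?_, fun y _ _ => by omega⟩, hrs⟩
    rw [hAL.stateLang_eq, hAL.stateLang_eq, hs.unrejected_eq, up_one_of_layer_eq_one hp, h, hrs,
      up_one_of_layer_eq_one hs₁]
  | @step p r' r hp hr' hanc hrec ih =>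
    have hlp := AL.layer_μ p hp
    have hlq := AL.layer_μ q (by omega)
    obtain ⟨s', hs', hsanc⟩ := hs.exists_parent (by omega)
    have hμ := (ih hs' (hanc.trans hrl) (hsanc.trans hsl) (by omega)).1
    have hrep : Represents AL A p r := .step hp hr' hanc hrec
    rcases le_total (A.layer r) (A.layer s) with hle | hle
    · exact hrec.eq_of_isAncestor_of_μ_eq hAL hA hnorm hmin hcentr (hs.isRecurrent (by omega)) hp
        hpq hμ (hrl.of_le hsl hle) hrep.unrejected_eq
    · have := (hs.isRecurrent (by omega)).eq_of_isAncestor_of_μ_eq hAL hA hnorm hmin hcentr hrec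
        (by omega) hpq.symm hμ.symm (hsl.of_le hrl hle) hs.unrejected_eq
      exact ⟨this.1.symm, this.2.symm⟩

theorem Represents.exists_up {p : QL} {r : Q} (h : Represents AL A p r) {x : ℕ} (hx : 1 ≤ x)
    (hxp : x ≤ AL.layer p) : ∃ s, Represents AL A (AL.up x p) s ∧ A.IsAncestor s r := by
  induction h with
  | @base p r hp hr h =>
    obtain rfl : x = AL.layer p := by omega
    exact ⟨r, by rw [up_layer_self]; exact .base hp hr h, A.isAncestor_refl r⟩
  | @step p r' r hp hr' hanc hrec ih =>
    rcases hxp.eq_or_lt with rfl | hlt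
    · exact ⟨r, by rw [up_layer_self]; exact .step hp hr' hanc hrec, A.isAncestor_refl r⟩
    · have := AL.layer_μ p hp
      obtain ⟨s, hs, hs'⟩ := ih (by omega)
      exact ⟨s, by rwa [AL.up_μ hp hlt] at hs, hs'.trans hanc⟩

/-- States with representatives that have a common descendant are comparable. -/
theorem Represents.isAncestor_of_le [Finite QL] [Finite Q] (hAL : AL.Consistent)
    (hA : A.Consistent) (hnorm : AL.Normal) (hmin : AL.SafeMinimal) (hcentr : AL.Centralised)
    {p q : QL} {r s l : Q} (hr : Represents AL A p r) (hs : Represents AL A q s)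
    (hrl : A.IsAncestor r l) (hsl : A.IsAncestor s l) (hpq : AL.layer p ≤ AL.layer q) :
    AL.IsAncestor p q := by
  obtain ⟨s', hs', hanc⟩ := hs.exists_up (AL.one_le_layer p) hpq
  exact ⟨hpq, (hr.eq_of_isAncestor hAL hA hnorm hmin hcentr hs' hrl (hanc.trans hsl)
    (AL.layer_up _ _ (AL.one_le_layer p) hpq).symm).1.symm⟩

/-- A state represents at most one state of the canonical automaton. -/
theorem Represents.eq [Finite QL] [Finite Q] (hAL : AL.Consistent)
    (hA : A.Consistent) (hnorm : AL.Normal) (hmin : AL.SafeMinimal) (hcentr : AL.Centralised)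
    {p q : QL} {r : Q} (hp : Represents AL A p r) (hq : Represents AL A q r) : p = q := by
  wlog hpq : AL.layer p ≤ AL.layer q generalizing p q
  · exact (this hq hp (by omega)).symm
  rcases hpq.eq_or_lt with heq | hlt
  · exact (hp.eq_of_isAncestor hAL hA hnorm hmin hcentr hq (A.isAncestor_refl r)
      (A.isAncestor_refl r) heq).1
  -- Otherwise the representative of the parent of `q` lies both above and below `r`.
  · have h₁ := AL.one_le_layer p
    have h₂ := AL.layer_μ q (by omega)
    obtain ⟨s, hs, hsr⟩ := hq.exists_parent (by omega)
    obtain ⟨s', hs', hanc⟩ := hs.exists_up (x := AL.layer p) h₁ (by omega)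
    obtain ⟨-, rfl⟩ := hp.eq_of_isAncestor hAL hA hnorm hmin hcentr hs' (A.isAncestor_refl r)
      (hanc.trans hsr) (AL.layer_up _ _ h₁ (by omega)).symm
    exact (hq.layer_ne hAL hA hnorm (by omega) hs (le_antisymm hsr.1 hanc.1)).elim

theorem represents_init (hAL : AL.Consistent) (hA : A.Consistent)
    (hequiv : A.language = AL.language) : Represents AL A AL.init A.init := by
  refine .base AL.layer_init A.layer_init ?_
  unfold language at hequiv
  rw [hA.stateLang_eq, hAL.stateLang_eq, up_one_of_layer_eq_one AL.layer_init,
    up_one_of_layer_eq_one A.layer_init] at hequiv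
  exact hequiv.symm

/-! ### The subautomaton of all representatives -/

/-- The representatives, each of them placed in the layer of the state that it represents and with
the transitions of that state only, form a subautomaton. -/
theorem exists_subautomaton [Finite QL] [Finite Q] (hAL : AL.Consistent)
    (hA : A.Consistent) (hnorm : AL.Normal) (hmin : AL.SafeMinimal) (hcentr : AL.Centralised)
    (hequiv : A.language = AL.language) :
    ∃ A' : LayeredAutomaton α {r : Q // ∃ p, Represents AL A p r}, IsSubautomaton A' A ∧
      ∃ φ, IsStrongMorphism A' AL φ ∧ Function.Surjective φ := by
  have hinit := represents_init hAL hA hequiv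
  have huniq : ∀ {p q r}, Represents AL A p r → Represents AL A q r → p = q :=
    fun h h' => h.eq hAL hA hnorm hmin hcentr h'
  let φ : {r : Q // ∃ p, Represents AL A p r} → QL := fun r => r.2.choose
  have hφ : ∀ r, Represents AL A (φ r) r.1 := fun r => r.2.choose_spec
  have hφ_mk : ∀ {p r} (h : Represents AL A p r), φ ⟨r, p, h⟩ = p := fun h => huniq (hφ _) h
  have exδ : ∀ r a, ∃ o : Option {r : Q // ∃ p, Represents AL A p r},
      (AL.δ (φ r) a = none → o = none) ∧ ∀ p, AL.δ (φ r) a = some p →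
        ∃ s, o = some s ∧ φ s = p ∧ A.δ r a = some s.1 := by
    intro r a
    cases hδ : AL.δ (φ r) a with
    | none => exact ⟨none, fun _ => rfl, fun p hp => (Option.some_ne_none p hp.symm).elim⟩
    | some p =>
      obtain ⟨s, hs⟩ := (hφ r).safeLE.exists_run (u := [a]) (by rw [run_singleton, hδ])
      have hps := (hφ r).of_run (u := [a]) (by rw [run_singleton, hδ]) hs
      rw [run_singleton] at hs
      refine ⟨some ⟨s, p, hps⟩, fun h => (Option.some_ne_none p h).elim, fun p' hp' => ?_⟩
      rw [← Option.some.inj hp']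
      exact ⟨_, rfl, hφ_mk hps, hs⟩
  choose δ hδ_none hδ_some using exδ
  have hδ : ∀ {r a s}, δ r a = some s → AL.δ (φ r) a = some (φ s) ∧ A.δ r a = some s.1 := by
    intro r a s h
    cases hp : AL.δ (φ r) a with
    | none =>
      rw [hδ_none r a hp] at h
      exact (Option.some_ne_none s h.symm).elim
    | some p =>
      obtain ⟨s', h₁, rfl, h₂⟩ := hδ_some r a p hp
      rw [h₁] at h
      obtain rfl := Option.some.inj h
      exact ⟨rfl, h₂⟩
  have exμ : ∀ r, ∃ s : {r : Q // ∃ p, Represents AL A p r}, 2 ≤ AL.layer (φ r) →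
      φ s = AL.μ (φ r) ∧ A.IsAncestor s.1 r.1 := by
    intro r
    by_cases hr : 2 ≤ AL.layer (φ r)
    · obtain ⟨s, hs, hanc⟩ := (hφ r).exists_parent hr
      exact ⟨⟨s, _, hs⟩, fun _ => ⟨hφ_mk hs, hanc⟩⟩
    · exact ⟨r, fun h => (hr h).elim⟩
  choose μ hμ using exμ
  let A' : LayeredAutomaton α {r : Q // ∃ p, Represents AL A p r} :=
    { d := AL.d
      layer := fun r => AL.layer (φ r)
      one_le_layer := fun r => AL.one_le_layer _
      layer_le := fun r => AL.layer_le _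
      δ := δ
      layer_δ := fun r a s h => AL.layer_δ _ _ _ (hδ h).1
      μ := μ
      layer_μ := fun r hr => by rw [(hμ r hr).1]; exact AL.layer_μ _ hr
      μ_morphism := fun r a s hr h => by
        obtain ⟨h₁, h₂⟩ := hδ h
        obtain ⟨h₃, h₄⟩ := hμ r hr
        obtain ⟨h₅, h₆⟩ := hμ s (by rw [AL.layer_δ _ _ _ h₁]; exact hr)
        obtain ⟨t, ht, htp, htδ⟩ := hδ_some (μ r) a (AL.μ (φ s))
          (by rw [h₃]; exact AL.μ_morphism _ _ _ hr h₁)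
        rw [← run_singleton] at h₂
        obtain ⟨t', ht', hanc⟩ := h₄.run h₂
        rw [run_singleton, htδ] at ht'
        obtain rfl := Option.some.inj ht'
        rw [ht, Option.some.injEq]
        exact Subtype.ext ((hφ t).eq_of_isAncestor hAL hA hnorm hmin hcentr (hφ (μ s)) hanc h₆
          (by rw [htp, h₅])).2
      complete_one := fun r a hr => by
        obtain ⟨p, hp⟩ := Option.isSome_iff_exists.mp (AL.complete_one (φ r) a hr)
        obtain ⟨s, hs, -⟩ := hδ_some r a p hp
        rw [hs]; rfl
      init := ⟨A.init, _, hinit⟩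
      layer_init := by rw [hφ_mk hinit]; exact AL.layer_init
      reachable_one := fun r hr => by
        have key : ∀ (u : List α) (s : {r : Q // ∃ p, Represents AL A p r}),
            AL.layer (φ s) = 1 → ∃ t, u.foldlM δ s = some t ∧ A.run s u = some t.1 := by
          intro u
          induction u with
          | nil => exact fun s _ => ⟨s, rfl, rfl⟩
          | cons a u ih =>
            intro s hs
            obtain ⟨p, hp⟩ := Option.isSome_iff_exists.mp (AL.complete_one (φ s) a hs)
            obtain ⟨s', h₁, rfl, h₂⟩ := hδ_some s a p hp
            obtain ⟨t, h₃, h₄⟩ := ih s' (by rw [AL.layer_δ _ _ _ hp, hs])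
            refine ⟨t, ?_, by rw [run_cons, h₂]; exact h₄⟩
            rw [List.foldlM_cons, h₁]
            exact h₃
        obtain ⟨u, hu⟩ := A.reachable_one r ((hφ r).layer_eq_one hr)
        obtain ⟨t, ht, htu⟩ := key u ⟨A.init, _, hinit⟩ (by rw [hφ_mk hinit]; exact AL.layer_init)
        refine ⟨u, ?_⟩
        rw [ht, Option.some.injEq]
        exact Subtype.ext (Option.some.inj (htu.symm.trans hu)) }
  have hiter : ∀ (n : ℕ) (r : {r : Q // ∃ p, Represents AL A p r}), n < AL.layer (φ r) →
      φ (μ^[n] r) = AL.μ^[n] (φ r) ∧ A.IsAncestor (μ^[n] r).1 r.1 := by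
    intro n r hn
    induction n with
    | zero => exact ⟨rfl, A.isAncestor_refl _⟩
    | succ n ih =>
      obtain ⟨h₁, h₂⟩ := ih (by omega)
      have h₃ := AL.layer_iterate_μ n (φ r) (by omega)
      obtain ⟨h₄, h₅⟩ := hμ (μ^[n] r) (by rw [h₁]; omega)
      rw [Function.iterate_succ_apply', Function.iterate_succ_apply']
      exact ⟨by rw [h₄, h₁], h₅.trans h₂⟩
  have hanc : ∀ r s, A'.IsAncestor r s → AL.IsAncestor (φ r) (φ s) ∧ A.IsAncestor r.1 s.1 := by
    rintro r s ⟨h₁, h₂⟩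
    have h₃ := AL.one_le_layer (φ r)
    obtain ⟨h₄, h₅⟩ := hiter (AL.layer (φ s) - AL.layer (φ r)) s (by
      have : AL.layer (φ r) ≤ AL.layer (φ s) := h₁
      omega)
    have h₆ : μ^[AL.layer (φ s) - AL.layer (φ r)] s = r := h₂
    rw [h₆] at h₄ h₅
    exact ⟨⟨h₁, h₄.symm⟩, h₅⟩
  refine ⟨A', ⟨Subtype.val, ⟨rfl, fun r a s h => (hδ h).2, fun r s h => (hanc r s h).2⟩,
    Subtype.val_injective⟩, φ, ⟨⟨hφ_mk hinit, fun r a s h => (hδ h).1,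
    fun r s h => (hanc r s h).1⟩, fun r a h => ?_⟩, fun p => ?_⟩
  · cases hp : AL.δ (φ r) a with
    | none => rfl
    | some p =>
      obtain ⟨s, hs, -⟩ := hδ_some r a p hp
      exact (Option.some_ne_none s (hs.symm.trans h)).elim
  · obtain ⟨r, hr⟩ := exists_represents hnorm hinit p
    exact ⟨⟨r, p, hr⟩, hφ_mk hr⟩

/-- Leaves below representatives of different leaves are different. -/
theorem card_leaf_le [Finite QL] [Finite Q] (hAL : AL.Consistent)
    (hA : A.Consistent) (hnorm : AL.Normal) (hmin : AL.SafeMinimal) (hcentr : AL.Centralised)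
    (hequiv : A.language = AL.language) : Nat.card AL.Leaf ≤ Nat.card A.Leaf := by
  have hinit := represents_init hAL hA hequiv
  choose r hr using exists_represents hnorm hinit
  choose f hf using A.exists_leaf
  have hleaf : ∀ {p q : QL}, AL.IsLeaf p → AL.IsAncestor p q → p = q := by
    intro p q hp h
    by_contra hne
    have hlt : AL.layer p < AL.layer q := by
      by_contra hle
      exact hne (h.eq (by omega))
    have h₁ := AL.one_le_layer p
    have h₂ := AL.layer_up (AL.layer p + 1) q (by omega) hlt
    refine hp ⟨AL.up (AL.layer p + 1) q, by omega, ?_⟩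
    rw [← AL.up_of_layer_eq_succ h₂, AL.up_up h₁ (by omega) hlt, h.2]
  have hinj : Function.Injective fun p : AL.Leaf => f (r p) := by
    intro p q hpq
    have hp := hf (r p)
    have hq := hf (r q)
    replace hpq : f (r p) = f (r q) := hpq
    rw [hpq] at hp
    refine Subtype.ext ?_
    rcases le_total (AL.layer p) (AL.layer q) with hle | hle
    · exact hleaf p.2 ((hr p).isAncestor_of_le hAL hA hnorm hmin hcentr (hr q) hp hq hle)
    · exact (hleaf q.2 ((hr q).isAncestor_of_le hAL hA hnorm hmin hcentr (hr p) hq hp hle)).symm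
  exact Nat.card_le_card_of_injective _ hinj

end Representation

end LayeredAutomaton

theorem mainTheorem3 {α : Type u} {QL : Type w} {Q : Type v} [Finite QL] [Finite Q]
    (AL : LayeredAutomaton α QL) (hconsL : AL.Consistent) (hnorm : AL.Normal)
    (hcentr : AL.Centralised) (hmin : AL.SafeMinimal)
    (A : LayeredAutomaton α Q) (hcons : A.Consistent) (hequiv : A.language = AL.language) :
    (∃ (Q' : Type v) (_ : Finite Q') (A' : LayeredAutomaton α Q'),
      LayeredAutomaton.IsSubautomaton A' A ∧
      ∃ φ : Q' → QL, LayeredAutomaton.IsStrongMorphism A' AL φ ∧ Function.Surjective φ) ∧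
    Nat.card QL ≤ Nat.card Q ∧
    Nat.card AL.Leaf ≤ Nat.card A.Leaf := by
  obtain ⟨A', hsub, φ, hφ, hsurj⟩ :=
    LayeredAutomaton.exists_subautomaton hconsL hcons hnorm hmin hcentr hequiv
  refine ⟨⟨_, inferInstance, A', hsub, φ, hφ, hsurj⟩, ?_,
    LayeredAutomaton.card_leaf_le hconsL hcons hnorm hmin hcentr hequiv⟩
  exact (Nat.card_le_card_of_surjective φ hsurj).trans
    (Nat.card_le_card_of_injective _ Subtype.val_injective)
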